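/- Let $K$ be an algebraically closed field of characteristic zero. For compositions $a=(a_1,\dots,a_m)$ and $b=(b_1,\dots,b_t)$ of a positive integer $n$ (sequences of positive integers with sum $n$), let $\mathfrak{p}_n(a,b)$ be the seaweed subalgebra of $\mathfrak{sl}(n)$ over $K$ of type $\frac{a_1|\cdots|a_m}{b_1|\cdots|b_t}$, that is, the Lie algebra of all traceless $n\times n$ matrices over $K$ that preserve every subspace $V_i=\mathrm{span}\{e_1,\dots,e_{a_1+\cdots+a_i}\}$ ($0\le i\le m$) and every subspace $W_j=\mathrm{span}\{e_{b_1+\cdots+b_j+1},\dots,e_n\}$ ($0\le j\le t$) of $K^n$, where $e_1,\dots,e_n$ is the standard basis. The index of a finite-dimensional Lie algebra $\mathfrak g$ over $K$ is $\operatorname{ind}\mathfrak g=\min_{f\in\mathfrak g^*}\dim\ker B_f$, where $B_f(x,y)=f([x,y])$. For an integer $k$, let $C(n,k)$ be the number of ordered pairs $(a,b)$ of compositions of $n$ such that $\operatorname{ind}\mathfrak{p}_n(a,b)=k$. Then, as formal power series with rational coefficients, $$\sum_{n>0}C(n,n-2)\,x^n=\frac{2x^2-2x^3}{(1-2x)^2}.$$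 (The term with $n=1$ is $C(1,-1)\,x=0$.) -/

import Mathlib

/-- The Kirillov form `B_f(x, y) = f([x, y])` of a linear form `f` on a Lie algebra. -/
def kirillovForm {K L : Type*} [CommRing K] [LieRing L] [LieAlgebra K L] (f : Module.Dual K L) :
    L →ₗ[K] L →ₗ[K] K :=
  LinearMap.mk₂ K (fun x y => f ⁅x, y⁆)
    (fun x x' y => by rw [add_lie, map_add])
    (fun c x y => by rw [smul_lie, map_smul])
    (fun x y y' => by rw [lie_add, map_add])
    (fun c x y => by rw [lie_smul, map_smul])

/-- The index of a finite-dimensional Lie algebra: the minimum, over all linear forms `f`, of the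
dimension of the kernel of the Kirillov form `B_f`. (An infimum of a nonempty set of natural
numbers is attained.) -/
noncomputable def lieIndex (K L : Type*) [Field K] [LieRing L] [LieAlgebra K L] : ℕ :=
  ⨅ f : Module.Dual K L, Module.finrank K (LinearMap.ker (kirillovForm f))

/-- `V_i = span {e_1, …, e_{a_1 + ⋯ + a_i}}`; the standard basis is indexed from `0` here.
For `i` at least the number of parts, this is the whole space. -/
def ascendingFlag (K : Type*) [Field K] {n : ℕ} (a : Composition n) (i : ℕ) :
    Submodule K (Fin n → K) :=
  Submodule.span K ((fun k : Fin n => (Pi.single k 1 : Fin n → K)) '' {k | (k : ℕ) < a.sizeUpTo i})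

/-- `W_j = span {e_{b_1 + ⋯ + b_j + 1}, …, e_n}`; the standard basis is indexed from `0` here.
For `j` at least the number of parts, this is zero. -/
def descendingFlag (K : Type*) [Field K] {n : ℕ} (b : Composition n) (j : ℕ) :
    Submodule K (Fin n → K) :=
  Submodule.span K ((fun k : Fin n => (Pi.single k 1 : Fin n → K)) '' {k | b.sizeUpTo j ≤ (k : ℕ)})

/-- The Lie subalgebra of those traceless matrices which map a given subspace into itself. -/
def slStabilizer (K : Type*) [Field K] {n : ℕ} (U : Submodule K (Fin n → K)) :
    LieSubalgebra K (LieAlgebra.SpecialLinear.sl (Fin n) K) where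
  carrier := {x | ∀ v ∈ U, (x : Matrix (Fin n) (Fin n) K).mulVec v ∈ U}
  zero_mem' := fun v _ => by simp
  add_mem' := fun {x y} hx hy v hv => by
    simpa [Matrix.add_mulVec] using U.add_mem (hx v hv) (hy v hv)
  smul_mem' := fun c x hx v hv => by
    simpa [Matrix.smul_mulVec] using U.smul_mem c (hx v hv)
  lie_mem' := fun {x y} hx hy v hv => by
    have h : ((⁅x, y⁆ : LieAlgebra.SpecialLinear.sl (Fin n) K) : Matrix (Fin n) (Fin n) K)
        = (x : Matrix (Fin n) (Fin n) K) * (y : Matrix (Fin n) (Fin n) K)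
          - (y : Matrix (Fin n) (Fin n) K) * (x : Matrix (Fin n) (Fin n) K) := by
      rfl
    rw [h, Matrix.sub_mulVec, ← Matrix.mulVec_mulVec, ← Matrix.mulVec_mulVec]
    exact U.sub_mem (hx _ (hy v hv)) (hy _ (hx v hv))

/-- The seaweed subalgebra of `𝔰𝔩(n)` of type `a / b`: the traceless matrices preserving every
member of the ascending flag of `a` and every member of the descending flag of `b`. -/
def seaweed (K : Type*) [Field K] {n : ℕ} (a b : Composition n) :
    LieSubalgebra K (LieAlgebra.SpecialLinear.sl (Fin n) K) :=
  (⨅ i : ℕ, slStabilizer K (ascendingFlag K a i)) ⊓ (⨅ j : ℕ, slStabilizer K (descendingFlag K b j))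

/-- `C(n, k)`: the number of ordered pairs of compositions of `n` whose seaweed subalgebra
of `𝔰𝔩(n)` over `K` has index `k`. Here `k` is an integer, so that `C(1, 1 - 2)` has its literal
meaning. -/
noncomputable def seaweedCount (K : Type*) [Field K] (n : ℕ) (k : ℤ) : ℕ :=
  Nat.card {p : Composition n × Composition n // (lieIndex K (seaweed K p.1 p.2) : ℤ) = k}

/-!
The seaweed subalgebra of `𝔰𝔩(n)` of type `a | b` has index `n - 2` if and only if one of the two
compositions arises from the other one by splitting a block of size `m + 2` into blocks of sizes
`1, m, 1` (or `1, 1` if `m = 0`); see `lieIndex_seaweed_eq_iff`. The number of such pairs is twice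
the total number of blocks of size at least two in the compositions of `n`, that is,
`n * 2 ^ (n - 2)` for `n ≥ 2` (`two_mul_sum_countP`), and these numbers have the asserted generating function.

The index is one less than that of the corresponding seaweed in `𝔤𝔩(n)`, and the latter is the
minimum over matrices `F` of the dimension of `patternStabilizer P F`, where `P` is the set of
positions of the seaweed.

Upper bounds come from reductions of the pair of compositions at the first blocks `k` of `a` and `m`
of `b`. If `k = m`, this block splits off and contributes `k`. If `k < m`, the form is extended by
arcs which join the first `min k (m - k)` indices to the last indices of the block `m`; the first
indices can then be removed without enlarging the stabilizer, and the remaining pair is again a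
seaweed (`StabilizerBound.eliminate`, `StabilizerBound.rotate`). By induction the index in `𝔤𝔩(n)`
is at most `n`. It is at most `n - 1` if `a ≠ b`, because every removal lowers `n`, and at most
`n - 2` unless a single index was removed and the remaining pair consists of equal compositions,
which means that a block was split (`stabilizerBound`).

Lower bounds hold for generic `F`, and then for all `F` because the dimension of the stabilizer is
upper semicontinuous along lines (`finite_setOf_finrank_patternStabilizer_lt`). If `a = b`, the
powers of a cyclic matrix give the dimension `n` (`card_le_finrank_patternStabilizer`). If the block
from index `i` to index `j` was split, the scalar matrices, together with matrices built from the
powers of the Schur complement of the entry `F i j`, give the dimension `n - 1`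
(`card_le_finrank_cutPattern`).
-/

/-! ### Semicontinuity of the kernel -/

/-- The kernel does not grow under a perturbation of a linear map, up to finitely many values of the
parameter. On a complement of `ker A`, with left inverse `g` of `A`, the exceptional parameters `t`
are those for which `-t⁻¹` is an eigenvalue of `g ∘ B`. -/
theorem finite_setOf_finrank_ker_lt_add_smul {K V W : Type*} [Field K] [AddCommGroup V]
    [Module K V] [FiniteDimensional K V] [AddCommGroup W] [Module K W] (A B : V →ₗ[K] W) :
    {t : K | ¬ Module.finrank K (LinearMap.ker (A + t • B)) ≤
      Module.finrank K (LinearMap.ker A)}.Finite := by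
  obtain ⟨U, hU⟩ := Submodule.exists_isCompl (LinearMap.ker A)
  have hinj : LinearMap.ker (A.domRestrict U) = ⊥ := by
    rw [LinearMap.ker_eq_bot']
    rintro ⟨u, hu⟩ h
    have : u ∈ LinearMap.ker A ⊓ U := ⟨h, hu⟩
    rw [hU.inf_eq_bot] at this
    exact Subtype.ext this
  obtain ⟨g, hg⟩ := (A.domRestrict U).exists_leftInverse_of_injective hinj
  let C : Module.End K U := g ∘ₗ B.domRestrict U
  have hfin : {μ : K | C.HasEigenvalue μ}.Finite := C.finite_hasEigenvalue
  refine ((hfin.preimage (f := fun t : K => -t⁻¹) ?_)).subset ?_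
  · intro s _ t _ h
    simpa using h
  intro t ht
  by_contra hne
  apply ht
  have hbot : LinearMap.ker (A + t • B) ⊓ U = ⊥ := by
    rw [eq_bot_iff]
    rintro u ⟨hu, huU⟩
    by_contra hu0
    have hu0' : (⟨u, huU⟩ : U) ≠ 0 := fun h => hu0 (congrArg Subtype.val h)
    have h1 : (⟨u, huU⟩ : U) + t • C ⟨u, huU⟩ = 0 := by
      have h2 : A u + t • B u = 0 := by simpa using hu
      have h3 := congrArg g h2
      have h4 : g (A u) = ⟨u, huU⟩ := LinearMap.congr_fun hg ⟨u, huU⟩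
      rw [map_add, map_smul, map_zero, h4] at h3
      exact h3
    have ht0 : t ≠ 0 := by
      rintro rfl
      rw [zero_smul, add_zero] at h1
      exact hu0' h1
    have h5 : C ⟨u, huU⟩ = (-t⁻¹) • (⟨u, huU⟩ : U) := by
      have h6 : t • C ⟨u, huU⟩ = -⟨u, huU⟩ := (neg_eq_of_add_eq_zero_right h1).symm
      rw [neg_smul, ← smul_neg, ← h6, smul_smul, inv_mul_cancel₀ ht0, one_smul]
    exact hne (Module.End.hasEigenvalue_of_hasEigenvector
      ⟨Module.End.mem_eigenspace_iff.mpr h5, hu0'⟩)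
  have h1 := Submodule.finrank_add_le_finrank_add_finrank (LinearMap.ker (A + t • B)) U
  have h2 := Submodule.finrank_sup_add_finrank_inf_eq (LinearMap.ker (A + t • B)) U
  have h3 := Submodule.finrank_add_eq_of_isCompl hU
  have h4 := Submodule.finrank_le (LinearMap.ker (A + t • B) ⊔ U)
  rw [hbot, finrank_bot] at h2
  omega

/-! ### Stabilizers of linear forms on matrix patterns -/

/-- Let `P` be a set of matrix positions, and let `q` be the space of matrices supported on `P`.
This is the space of all `x` in `q` with `tr (F [x, y]) = tr ([F, x] y) = 0` for all `y` in `q`,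
the second condition being spelled out on the matrix units `y`. If `q` is a Lie algebra, this is
the kernel of the Kirillov form of `tr (F ·)` on `q`. -/
def patternStabilizer {K ι : Type*} [Field K] [Fintype ι] (P : ι → ι → Prop) (F : Matrix ι ι K) :
    Submodule K (Matrix ι ι K) where
  carrier := {x | (∀ i j, ¬ P i j → x i j = 0) ∧ ∀ i j, P i j → (F * x - x * F) j i = 0}
  zero_mem' := by simp
  add_mem' := by
    rintro x y ⟨hx, hx'⟩ ⟨hy, hy'⟩
    refine ⟨fun i j h => by simp [hx i j h, hy i j h], fun i j h => ?_⟩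
    have : F * (x + y) - (x + y) * F = (F * x - x * F) + (F * y - y * F) := by noncomm_ring
    rw [this, Matrix.add_apply, hx' i j h, hy' i j h, add_zero]
  smul_mem' := by
    rintro c x ⟨hx, hx'⟩
    refine ⟨fun i j h => by simp [hx i j h], fun i j h => ?_⟩
    have : F * (c • x) - (c • x) * F = c • (F * x - x * F) := by
      simp [smul_sub]
    rw [this, Matrix.smul_apply, hx' i j h, smul_zero]

section

variable {K ι κ : Type*} [Field K] [Fintype ι] [Fintype κ]

theorem mem_patternStabilizer {P : ι → ι → Prop} {F x : Matrix ι ι K} :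
    x ∈ patternStabilizer P F ↔
      (∀ i j, ¬ P i j → x i j = 0) ∧ ∀ i j, P i j → (F * x - x * F) j i = 0 :=
  Iff.rfl

/-- Semicontinuity of the stabilizer: this is used both to move a form with small stabilizer into
general position and to extend lower bounds from generic forms to all forms. -/
theorem finite_setOf_finrank_patternStabilizer_lt (P : ι → ι → Prop) (F H : Matrix ι ι K) :
    {t : K | ¬ Module.finrank K (patternStabilizer P (F + t • H)) ≤
      Module.finrank K (patternStabilizer P F)}.Finite := by
  classical
  -- `A + t • B` records the equations which define the stabilizer of `F + t • H`
  let A : Matrix ι ι K →ₗ[K] Matrix ι ι K :=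
    { toFun := fun x => Matrix.of fun i j => if P i j then (F * x - x * F) j i else x i j
      map_add' := fun x y => by
        ext i j
        by_cases h : P i j <;> simp [h, mul_add, add_mul]
        abel
      map_smul' := fun c x => by
        ext i j
        by_cases h : P i j <;> simp [h, mul_sub] }
  let B : Matrix ι ι K →ₗ[K] Matrix ι ι K :=
    { toFun := fun x => Matrix.of fun i j => if P i j then (H * x - x * H) j i else 0
      map_add' := fun x y => by
        ext i j
        by_cases h : P i j <;> simp [h, mul_add, add_mul]
        abel
      map_smul' := fun c x => by
        ext i j
        by_cases h : P i j <;> simp [h, mul_sub] }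
  have key : ∀ t : K, patternStabilizer P (F + t • H) = LinearMap.ker (A + t • B) := by
    intro t
    ext x
    rw [mem_patternStabilizer, LinearMap.mem_ker, ← Matrix.ext_iff]
    have h : ∀ i j, (A + t • B) x i j =
        if P i j then ((F + t • H) * x - x * (F + t • H)) j i else x i j := by
      intro i j
      change (if P i j then (F * x - x * F) j i else x i j) +
        t * (if P i j then (H * x - x * H) j i else 0) = _
      by_cases h : P i j
      · simp only [h, if_true, add_mul, mul_add, Matrix.smul_mul, Matrix.mul_smul,
          Matrix.sub_apply, Matrix.add_apply, Matrix.smul_apply, smul_eq_mul]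
        ring
      · simp [h]
    constructor
    · rintro ⟨h1, h2⟩ i j
      rw [h]
      split_ifs with hP
      · exact h2 i j hP
      · exact h1 i j hP
    · intro h1
      exact ⟨fun i j hP => by simpa [h, hP] using h1 i j,
        fun i j hP => by
          have := h1 i j
          rw [h, if_pos hP] at this
          exact this⟩
  have h0 : patternStabilizer P F = LinearMap.ker A := by simpa using key 0
  refine (finite_setOf_finrank_ker_lt_add_smul A B).subset fun t ht => ?_
  rw [Set.mem_ofPred_eq, ← key, ← h0]
  exact ht

theorem finrank_patternStabilizer_reindex (e : ι ≃ κ) (P : κ → κ → Prop) (F : Matrix κ κ K) :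
    Module.finrank K (patternStabilizer (fun i j => P (e i) (e j)) (F.submatrix e e)) =
      Module.finrank K (patternStabilizer P F) := by
  refine (LinearEquiv.ofSubmodules (Matrix.reindexLinearEquiv K K e.symm e.symm)
    (patternStabilizer P F) _ ?_).finrank_eq.symm
  ext x
  rw [Submodule.mem_map_equiv]
  simp only [mem_patternStabilizer]
  have hx : (Matrix.reindexLinearEquiv K K e.symm e.symm).symm x = x.submatrix e.symm e.symm := rfl
  have hc : F * x.submatrix e.symm e.symm - x.submatrix e.symm e.symm * F =
      (F.submatrix e e * x - x * F.submatrix e e).submatrix e.symm e.symm := by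
    ext i j
    simp only [Matrix.submatrix_apply, Matrix.sub_apply, Matrix.mul_apply]
    congr 1
    · exact (Fintype.sum_equiv e _ _ (fun k => by simp)).symm
    · exact (Fintype.sum_equiv e _ _ (fun k => by simp)).symm
  rw [hx, hc]
  constructor
  · rintro ⟨h1, h2⟩
    exact ⟨fun i j h => by simpa using h1 _ _ h, fun i j h => by simpa using h2 _ _ h⟩
  · rintro ⟨h1, h2⟩
    exact ⟨fun i j h => h1 _ _ (by simpa using h), fun i j h => h2 _ _ (by simpa using h)⟩

theorem finrank_patternStabilizer_transpose (P : ι → ι → Prop) (F : Matrix ι ι K) :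
    Module.finrank K (patternStabilizer (fun i j => P j i) F.transpose) =
      Module.finrank K (patternStabilizer P F) := by
  refine (LinearEquiv.ofSubmodules (Matrix.transposeLinearEquiv ι ι K K)
    (patternStabilizer P F) _ ?_).finrank_eq.symm
  ext x
  rw [Submodule.mem_map_equiv]
  simp only [mem_patternStabilizer]
  have hx : (Matrix.transposeLinearEquiv ι ι K K).symm x = x.transpose := rfl
  have hc : ∀ i j, (F.transpose * x - x * F.transpose) j i =
      - (F * x.transpose - x.transpose * F) i j := by
    intro i j
    have : F.transpose * x - x * F.transpose = -(F * x.transpose - x.transpose * F).transpose := by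
      simp
    rw [this]; rfl
  simp only [hx, hc, neg_eq_zero]
  exact ⟨fun h => ⟨fun i j => h.1 j i, fun i j => h.2 j i⟩,
    fun h => ⟨fun i j => h.1 j i, fun i j => h.2 j i⟩⟩

end

/-! ### Reduction steps for upper bounds -/

section

variable {K α κ : Type*} [Field K] [Fintype α] [Fintype κ]

/-- Splitting off a full matrix block: on that block take a diagonal form with distinct entries,
whose stabilizer consists of the diagonal matrices. -/
theorem exists_finrank_patternStabilizer_le_card_add [CharZero K] (P : α ⊕ κ → α ⊕ κ → Prop)
    (hαα : ∀ a b, P (.inl a) (.inl b)) (hακ : ∀ a u, ¬ P (.inl a) (.inr u))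
    (hκα : ∀ u a, ¬ P (.inr u) (.inl a)) (F : Matrix κ κ K) :
    ∃ G : Matrix (α ⊕ κ) (α ⊕ κ) K, Module.finrank K (patternStabilizer P G) ≤
      Fintype.card α + Module.finrank K
        (patternStabilizer (fun u v => P (.inr u) (.inr v)) F) := by
  classical
  let d : α → K := fun a => ((Fintype.equivFin α a : ℕ) : K)
  have hd : Function.Injective d := fun a b h => by
    have := Nat.cast_injective h
    exact (Fintype.equivFin α).injective (Fin.ext this)
  refine ⟨Matrix.fromBlocks (Matrix.diagonal d) 0 0 F, ?_⟩
  set G : Matrix (α ⊕ κ) (α ⊕ κ) K := Matrix.fromBlocks (Matrix.diagonal d) 0 0 F with hG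
  have hGx : ∀ x : Matrix (α ⊕ κ) (α ⊕ κ) K, G * x - x * G = Matrix.fromBlocks
      (Matrix.diagonal d * x.toBlocks₁₁ - x.toBlocks₁₁ * Matrix.diagonal d)
      (Matrix.diagonal d * x.toBlocks₁₂ - x.toBlocks₁₂ * F)
      (F * x.toBlocks₂₁ - x.toBlocks₂₁ * Matrix.diagonal d)
      (F * x.toBlocks₂₂ - x.toBlocks₂₂ * F) := by
    intro x
    conv_lhs => rw [← Matrix.fromBlocks_toBlocks x]
    rw [hG, Matrix.fromBlocks_multiply, Matrix.fromBlocks_multiply, sub_eq_add_neg,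
      Matrix.fromBlocks_neg, Matrix.fromBlocks_add]
    simp [sub_eq_add_neg]
  let φ : patternStabilizer P G →ₗ[K]
      (α → K) × patternStabilizer (fun u v => P (.inr u) (.inr v)) F :=
    { toFun := fun x => (fun a => x.1 (.inl a) (.inl a),
        ⟨x.1.toBlocks₂₂, fun i j h => x.2.1 _ _ h, fun i j h => by
          have := x.2.2 _ _ h
          rwa [hGx] at this⟩)
      map_add' := fun x y => rfl
      map_smul' := fun c x => rfl }
  have hφ : Function.Injective φ := by
    rw [← LinearMap.ker_eq_bot, LinearMap.ker_eq_bot']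
    intro x hx
    have h1 : ∀ a, x.1 (.inl a) (.inl a) = 0 := fun a => congrFun (congrArg Prod.fst hx) a
    have h2 : x.1.toBlocks₂₂ = 0 := congrArg (fun y => (y.2 : Matrix κ κ K)) hx
    apply Subtype.ext
    ext i j
    rcases i with i | i <;> rcases j with j | j
    · by_cases hij : i = j
      · subst hij; exact h1 i
      · have h4 := x.2.2 _ _ (hαα j i)
        rw [hGx] at h4
        simp only [Matrix.fromBlocks_apply₁₁, Matrix.sub_apply, Matrix.diagonal_mul,
          Matrix.mul_diagonal] at h4
        rw [mul_comm, ← mul_sub] at h4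
        rcases mul_eq_zero.mp h4 with h5 | h5
        · exact h5
        · exact absurd (hd (sub_eq_zero.mp h5)) hij
    · exact x.2.1 _ _ (hακ i j)
    · exact x.2.1 _ _ (hκα i j)
    · exact congrFun (congrFun h2 i) j
  have := LinearMap.finrank_le_finrank_of_injective hφ
  rwa [Module.finrank_prod, Module.finrank_fintype_fun_eq_card] at this

open Classical in
/-- The extension of `F` by arcs joining each new index `a` to the old index `l a`: as an operator,
it sends `e_a` to `e_{l a}` and acts by `F` on the old basis vectors. -/
noncomputable def arcExtension (l : α → κ) (F : Matrix κ κ K) : Matrix (α ⊕ κ) (α ⊕ κ) K :=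
  Matrix.fromBlocks 0 0 (Matrix.of fun u a => if u = l a then 1 else 0) F

theorem arcExtension_mul_inl (l : α → κ) (F : Matrix κ κ K) (x : Matrix (α ⊕ κ) (α ⊕ κ) K)
    (a : α) (c : α ⊕ κ) : (arcExtension l F * x) (.inl a) c = 0 := by
  simp [arcExtension, Matrix.mul_apply]

theorem arcExtension_mul_inr_apply {l : α → κ} (hl : Function.Injective l) (F : Matrix κ κ K)
    (x : Matrix (α ⊕ κ) (α ⊕ κ) K) (a : α) (c : α ⊕ κ) :
    (arcExtension l F * x) (.inr (l a)) c =
      x (.inl a) c + ∑ w, F (l a) w * x (.inr w) c := by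
  classical
  simp [arcExtension, Matrix.mul_apply, hl.eq_iff]

theorem arcExtension_mul_inr_of_notMem {l : α → κ} (F : Matrix κ κ K)
    (x : Matrix (α ⊕ κ) (α ⊕ κ) K) {u : κ} (hu : ∀ a, u ≠ l a) (c : α ⊕ κ) :
    (arcExtension l F * x) (.inr u) c = ∑ w, F u w * x (.inr w) c := by
  classical
  simp [arcExtension, Matrix.mul_apply, hu]

theorem mul_arcExtension_inl (l : α → κ) (F : Matrix κ κ K) (x : Matrix (α ⊕ κ) (α ⊕ κ) K)
    (a : α) (c : α ⊕ κ) : (x * arcExtension l F) c (.inl a) = x c (.inr (l a)) := by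
  classical
  simp [arcExtension, Matrix.mul_apply]

theorem mul_arcExtension_inr (l : α → κ) (F : Matrix κ κ K) (x : Matrix (α ⊕ κ) (α ⊕ κ) K)
    (v : κ) (c : α ⊕ κ) : (x * arcExtension l F) c (.inr v) = ∑ w, x c (.inr w) * F w v := by
  classical
  simp [arcExtension, Matrix.mul_apply]

/-- Block elimination. The new rows extend to the right over the columns in `J` and in the range of
`l`, and the new columns are zero below the block of new indices. An element of the stabilizer of
the extended form is determined by its old block `x`: the rows in `J` of `x` vanish in the columns
in the range of `l`, which is why the smaller pattern `Q` omits these positions, and in exchange the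
equations at these positions determine the entries of the new rows. -/
theorem finrank_patternStabilizer_arcExtension_le (P : α ⊕ κ → α ⊕ κ → Prop)
    (Q : κ → κ → Prop) (l : α → κ) (hl : Function.Injective l) (J : κ → Prop)
    (hJl : ∀ a, ¬ J (l a))
    (hαα : ∀ a b, P (.inl a) (.inl b)) (hακ : ∀ a u, P (.inl a) (.inr u) ↔ J u ∨ ∃ b, u = l b)
    (hκα : ∀ u a, ¬ P (.inr u) (.inl a))
    (hQ : ∀ u v, Q u v ↔ P (.inr u) (.inr v) ∧ ¬ (J u ∧ ∃ b, v = l b))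
    (hJP : ∀ u b, J u → P (.inr u) (.inr (l b))) (F : Matrix κ κ K) :
    Module.finrank K (patternStabilizer P (arcExtension l F)) ≤
      Module.finrank K (patternStabilizer Q F) := by
  classical
  have hZ : ∀ x ∈ patternStabilizer P (arcExtension l F), ∀ u a, x (.inr u) (.inl a) = 0 :=
    fun x hx u a => hx.1 _ _ (hκα u a)
  have hYl : ∀ x ∈ patternStabilizer P (arcExtension l F), ∀ a b,
      x (.inl a) (.inr (l b)) = 0 := by
    intro x hx a b
    have := hx.2 _ _ (hαα b a)
    rwa [Matrix.sub_apply, arcExtension_mul_inl, mul_arcExtension_inl, zero_sub,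
      neg_eq_zero] at this
  have hJ0 : ∀ x ∈ patternStabilizer P (arcExtension l F), ∀ u b, J u →
      x (.inr u) (.inr (l b)) = 0 := by
    intro x hx u b hu
    have := hx.2 _ _ ((hακ b u).2 (.inl hu))
    rw [Matrix.sub_apply, arcExtension_mul_inr_of_notMem F x (l := l) (u := u)
      (fun a h => hJl a (h ▸ hu)),
      mul_arcExtension_inl] at this
    simpa [hZ x hx] using this
  have hA : ∀ x ∈ patternStabilizer P (arcExtension l F), ∀ a b,
      x (.inl a) (.inl b) = x (.inr (l a)) (.inr (l b)) := by
    intro x hx a b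
    have := hx.2 _ _ ((hακ b (l a)).2 (.inr ⟨a, rfl⟩))
    rw [Matrix.sub_apply, arcExtension_mul_inr_apply hl, mul_arcExtension_inl] at this
    simpa [hZ x hx, sub_eq_zero] using this
  have hmul : ∀ x : Matrix (α ⊕ κ) (α ⊕ κ) K, ∀ u v,
      (F * x.toBlocks₂₂ - x.toBlocks₂₂ * F) u v =
      (∑ w, F u w * x (.inr w) (.inr v)) - ∑ w, x (.inr u) (.inr w) * F w v := fun x u v => rfl
  let φ : patternStabilizer P (arcExtension l F) →ₗ[K] patternStabilizer Q F :=
    { toFun := fun x => ⟨x.1.toBlocks₂₂, by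
        constructor
        · intro u v h
          rw [hQ, not_and_or, not_not] at h
          rcases h with h | ⟨hu, b, rfl⟩
          · exact x.2.1 _ _ h
          · exact hJ0 x.1 x.2 u b hu
        · intro u v h
          obtain ⟨h1, h2⟩ := (hQ u v).1 h
          have h3 := x.2.2 _ _ h1
          rw [Matrix.sub_apply, mul_arcExtension_inr] at h3
          rw [hmul, ← h3]
          congr 1
          by_cases hv : ∃ a, v = l a
          · obtain ⟨a, rfl⟩ := hv
            rw [arcExtension_mul_inr_apply hl, right_eq_add]
            by_cases hu : J u ∨ ∃ b, u = l b
            · rcases hu with hu | ⟨b, rfl⟩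
              · exact absurd ⟨hu, a, rfl⟩ h2
              · exact hYl x.1 x.2 a b
            · exact x.2.1 _ _ (fun h => hu ((hακ a u).1 h))
          · rw [arcExtension_mul_inr_of_notMem F x.1 (fun a h => hv ⟨a, h⟩)]⟩
      map_add' := fun x y => rfl
      map_smul' := fun c x => rfl }
  refine LinearMap.finrank_le_finrank_of_injective (f := φ) ?_
  rw [← LinearMap.ker_eq_bot, LinearMap.ker_eq_bot']
  intro x hx
  have h0 : ∀ u v, x.1 (.inr u) (.inr v) = 0 := fun u v =>
    congrFun (congrFun (congrArg Subtype.val hx) u) v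
  apply Subtype.ext
  ext i j
  rcases i with i | i <;> rcases j with j | j
  · rw [hA x.1 x.2, h0]; rfl
  · by_cases hj : J j ∨ ∃ b, j = l b
    · rcases hj with hj | ⟨b, rfl⟩
      · have h3 := x.2.2 _ _ (hJP j i hj)
        rw [Matrix.sub_apply, mul_arcExtension_inr, arcExtension_mul_inr_apply hl] at h3
        simpa [h0] using h3
      · exact hYl x.1 x.2 i b
    · exact x.2.1 _ _ (fun h => hj ((hακ i j).1 h))
  · exact hZ x.1 x.2 i j
  · exact h0 i j

/-- Rotation contraction. Here the new columns extend below the block of new indices over the rows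
in `J`. If the block of `F` at `J` is invertible, then the equations at the new rows and columns
force the entries which join the new indices to `J` to vanish, and nothing is lost by restricting to
the old indices. -/
theorem finrank_patternStabilizer_arcExtension_le_of_invertible (P : α ⊕ κ → α ⊕ κ → Prop)
    (l : α → κ) (hl : Function.Injective l) (J : κ → Prop)
    (hJl : ∀ a, ¬ J (l a))
    (hαα : ∀ a b, P (.inl a) (.inl b)) (hακ : ∀ a u, P (.inl a) (.inr u) ↔ J u ∨ ∃ b, u = l b)
    (hκα : ∀ u a, P (.inr u) (.inl a) ↔ J u) (F : Matrix κ κ K)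
    (hF : ∀ v : κ → K, (∀ u, ¬ J u → v u = 0) → (∀ u, J u → ∑ w, F u w * v w = 0) → v = 0)
    (hF' : ∀ v : κ → K, (∀ u, ¬ J u → v u = 0) → (∀ u, J u → ∑ w, v w * F w u = 0) → v = 0) :
    Module.finrank K (patternStabilizer P (arcExtension l F)) ≤
      Module.finrank K (patternStabilizer (fun u v => P (.inr u) (.inr v)) F) := by
  classical
  have hYl : ∀ x ∈ patternStabilizer P (arcExtension l F), ∀ a b,
      x (.inl a) (.inr (l b)) = 0 := by
    intro x hx a b
    have := hx.2 _ _ (hαα b a)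
    rwa [Matrix.sub_apply, arcExtension_mul_inl, mul_arcExtension_inl, zero_sub,
      neg_eq_zero] at this
  have hY : ∀ x ∈ patternStabilizer P (arcExtension l F), ∀ a u,
      x (.inl a) (.inr u) = 0 := by
    intro x hx a
    refine congrFun (hF' (fun u => x (.inl a) (.inr u)) (fun u hu => ?_) (fun u hu => ?_))
    · by_cases h : ∃ b, u = l b
      · obtain ⟨b, rfl⟩ := h
        exact hYl x hx a b
      · exact hx.1 _ _ (fun h' => ((hακ a u).1 h').elim hu h)
    · have := hx.2 _ _ ((hκα u a).2 hu)
      rwa [Matrix.sub_apply, arcExtension_mul_inl, mul_arcExtension_inr, zero_sub,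
        neg_eq_zero] at this
  let φ : patternStabilizer P (arcExtension l F) →ₗ[K]
      patternStabilizer (fun u v => P (.inr u) (.inr v)) F :=
    { toFun := fun x => ⟨x.1.toBlocks₂₂, by
        refine ⟨fun u v h => x.2.1 _ _ h, fun u v h => ?_⟩
        have h3 := x.2.2 _ _ h
        rw [Matrix.sub_apply, mul_arcExtension_inr] at h3
        change (∑ w, F v w * x.1 (.inr w) (.inr u)) - ∑ w, x.1 (.inr v) (.inr w) * F w u = 0
        rw [← h3]
        congr 1
        by_cases hv : ∃ a, v = l a
        · obtain ⟨a, rfl⟩ := hv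
          rw [arcExtension_mul_inr_apply hl, right_eq_add]
          exact hY x.1 x.2 a u
        · rw [arcExtension_mul_inr_of_notMem F x.1 (fun a h => hv ⟨a, h⟩)]⟩
      map_add' := fun x y => rfl
      map_smul' := fun c x => rfl }
  refine LinearMap.finrank_le_finrank_of_injective (f := φ) ?_
  rw [← LinearMap.ker_eq_bot, LinearMap.ker_eq_bot']
  intro x hx
  have h0 : ∀ u v, x.1 (.inr u) (.inr v) = 0 := fun u v =>
    congrFun (congrFun (congrArg Subtype.val hx) u) v
  have hZ : ∀ a u, x.1 (.inr u) (.inl a) = 0 := by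
    intro a
    refine congrFun (hF (fun u => x.1 (.inr u) (.inl a)) (fun u hu => ?_) (fun u hu => ?_))
    · exact x.2.1 _ _ (fun h => hu ((hκα u a).1 h))
    · have := x.2.2 _ _ ((hακ a u).2 (.inl hu))
      rw [Matrix.sub_apply,
        arcExtension_mul_inr_of_notMem F x.1 (l := l) (u := u)
          (fun b h => hJl b (h ▸ hu)),
        mul_arcExtension_inl, h0, sub_zero] at this
      exact this
  apply Subtype.ext
  ext i j
  rcases i with i | i <;> rcases j with j | j
  · have := x.2.2 _ _ ((hακ j (l i)).2 (.inr ⟨i, rfl⟩))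
    rw [Matrix.sub_apply, arcExtension_mul_inr_apply hl, mul_arcExtension_inl] at this
    simpa [hZ, h0] using this
  · exact hY x.1 x.2 i j
  · exact hZ j i
  · exact h0 i j

open Classical in
/-- Adding `t` times the identity to the block of `F` at `J` makes it injective unless `-t` is an
eigenvalue of that block. -/
theorem exists_finite_forall_notMem_injOn (J : κ → Prop) (F : Matrix κ κ K) :
    ∃ S : Set K, S.Finite ∧ ∀ t ∉ S, ∀ v : κ → K, (∀ u, ¬ J u → v u = 0) →
      (∀ u, J u → ∑ w, (F + t • Matrix.diagonal fun w => if J w then (1 : K) else 0 :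
        Matrix κ κ K) u w * v w = 0) →
      v = 0 := by
  let E : Matrix κ κ K := Matrix.of fun u w => if J u ∧ J w then F u w else 0
  refine ⟨(fun t : K => -t) ⁻¹' {μ | Module.End.HasEigenvalue (Matrix.toLin' E) μ},
    (Module.End.finite_hasEigenvalue (Matrix.toLin' E)).preimage neg_injective.injOn, ?_⟩
  intro t ht v hv hv'
  by_contra hv0
  refine ht (Module.End.hasEigenvalue_of_hasEigenvector
    ⟨Module.End.mem_eigenspace_iff.mpr ?_, hv0⟩)
  ext u
  rw [Matrix.toLin'_apply]
  by_cases hu : J u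
  · have h1 := hv' u hu
    have h2 : ∀ w, (F + t • Matrix.diagonal fun w => if J w then (1 : K) else 0 :
        Matrix κ κ K) u w * v w =
        E u w * v w + if u = w then t * v w else 0 := by
      intro w
      by_cases hw : J w
      · by_cases huw : u = w
        · subst huw
          simp [E, hu]
          ring
        · simp [E, hu, hw, huw]
      · simp [hv w hw]
    simp only [h2, Finset.sum_add_distrib, Finset.sum_ite_eq, Finset.mem_univ, if_true] at h1
    change ∑ w, E u w * v w = -t * v u
    linear_combination h1
  · have h2 : ∀ w, E u w * v w = 0 := fun w => by simp [E, hu]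
    change ∑ w, E u w * v w = -t * v u
    simp [h2, hv u hu]

/-- A generic shift along the diagonal makes a principal block of `F` invertible without enlarging
the stabilizer. The invertibility is expressed by the triviality of the left and right kernels. -/
theorem exists_patternStabilizer_block_invertible [CharZero K] (P : κ → κ → Prop) (J : κ → Prop)
    (F : Matrix κ κ K) : ∃ G : Matrix κ κ K,
      Module.finrank K (patternStabilizer P G) ≤ Module.finrank K (patternStabilizer P F) ∧
      (∀ v : κ → K, (∀ u, ¬ J u → v u = 0) → (∀ u, J u → ∑ w, G u w * v w = 0) → v = 0) ∧
      (∀ v : κ → K, (∀ u, ¬ J u → v u = 0) → (∀ u, J u → ∑ w, v w * G w u = 0) → v = 0) := by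
  classical
  obtain ⟨S, hS, hS'⟩ := exists_finite_forall_notMem_injOn J F
  obtain ⟨T, hT, hT'⟩ := exists_finite_forall_notMem_injOn J F.transpose
  obtain ⟨t, ht⟩ := ((hS.union hT).union (finite_setOf_finrank_patternStabilizer_lt P F
    (Matrix.diagonal fun w => if J w then 1 else 0))).exists_notMem
  simp only [Set.mem_union, not_or] at ht
  refine ⟨_, not_not.mp ht.2, hS' t ht.1.1, fun v hv hv' => hT' t ht.1.2 v hv fun u hu => ?_⟩
  refine (Finset.sum_congr rfl fun w _ => ?_).trans (hv' u hu)
  rw [mul_comm]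
  congr 1
  by_cases huw : u = w
  · subst huw; simp
  · simp [huw, Ne.symm huw]

end

/-! ### Patterns of pairs of lists -/

/-- The position `(k, l)` (row `k`, column `l`, counted from `0`) is allowed in a
matrix preserving the coordinate subspaces spanned by the first `L₁ + ⋯ + Lᵢ` standard basis vectors,
for all `i`. -/
def FlagLE (L : List ℕ) (k l : ℕ) : Prop :=
  ∀ i, l < (L.take i).sum → k < (L.take i).sum

theorem FlagLE.refl (L : List ℕ) (k : ℕ) : FlagLE L k k := fun _ h => h

theorem FlagLE.trans {L : List ℕ} {k l m : ℕ} (h : FlagLE L k l) (h' : FlagLE L l m) :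
    FlagLE L k m := fun i hi => h i (h' i hi)

theorem flagLE_of_le (L : List ℕ) {k l : ℕ} (h : k ≤ l) : FlagLE L k l :=
  fun _ hi => lt_of_le_of_lt h hi

theorem flagLE_cons_of_lt {h k : ℕ} (L : List ℕ) (l : ℕ) (hk : k < h) : FlagLE (h :: L) k l := by
  rintro (_ | i) hi
  · simp at hi
  · rw [List.take_succ_cons, List.sum_cons]
    omega

theorem not_flagLE_cons {h k l : ℕ} (L : List ℕ) (hk : h ≤ k) (hl : l < h) :
    ¬ FlagLE (h :: L) k l := by
  intro H
  have := H 1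
  simp at this
  omega

theorem flagLE_cons_iff_of_lt {h k l : ℕ} (L : List ℕ) (hl : l < h) :
    FlagLE (h :: L) k l ↔ k < h :=
  ⟨fun H => not_le.mp fun hk => not_flagLE_cons L hk hl H, flagLE_cons_of_lt L l⟩

theorem flagLE_cons_add (s h : ℕ) (L : List ℕ) (k l : ℕ) :
    FlagLE ((s + h) :: L) (s + k) (s + l) ↔ FlagLE (h :: L) k l := by
  constructor
  · rintro H (_ | i) hi
    · simp at hi
    · have := H (i + 1)
      simp only [List.take_succ_cons, List.sum_cons] at this hi ⊢
      omega
  · rintro H (_ | i) hi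
    · simp at hi
    · have := H (i + 1)
      simp only [List.take_succ_cons, List.sum_cons] at this hi ⊢
      omega

theorem flagLE_zero_cons (L : List ℕ) (k l : ℕ) : FlagLE (0 :: L) k l ↔ FlagLE L k l := by
  constructor
  · intro H i hi
    have := H (i + 1)
    simp only [List.take_succ_cons, List.sum_cons, zero_add] at this
    exact this hi
  · rintro H (_ | i) hi
    · simp at hi
    · simp only [List.take_succ_cons, List.sum_cons, zero_add] at hi ⊢
      exact H i hi

theorem flagLE_cons_self_add (h : ℕ) (L : List ℕ) (k l : ℕ) :
    FlagLE (h :: L) (h + k) (h + l) ↔ FlagLE L k l := by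
  rw [← flagLE_zero_cons L, ← flagLE_cons_add h 0, add_zero]

/-- The positions of the entries of the seaweed of type `a | b` which may be nonzero. The condition
of the descending flag of `b` is that of the ascending one with rows and columns exchanged. -/
def seaweedPattern (a b : List ℕ) (n : ℕ) (k l : Fin n) : Prop :=
  FlagLE a k l ∧ FlagLE b l k

theorem seaweedPattern_swap (a b : List ℕ) (n : ℕ) :
    (fun k l => seaweedPattern a b n l k) = seaweedPattern b a n := by
  funext k l
  exact propext and_comm

/-- `StabilizerBound K a b n d`: some linear form on the seaweed of type `a | b` in `𝔤𝔩(n)` has a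
stabilizer of dimension at most `n - d`. The inequality is stated without subtraction. -/
def StabilizerBound (K : Type*) [Field K] (a b : List ℕ) (n d : ℕ) : Prop :=
  ∃ F : Matrix (Fin n) (Fin n) K,
    Module.finrank K (patternStabilizer (seaweedPattern a b n) F) + d ≤ n

/-- `m :: L`, with an empty block omitted. -/
def consBlock (m : ℕ) (L : List ℕ) : List ℕ := if m = 0 then L else m :: L

theorem flagLE_consBlock (m : ℕ) (L : List ℕ) (k l : ℕ) :
    FlagLE (consBlock m L) k l ↔ FlagLE (m :: L) k l := by
  unfold consBlock
  split_ifs with h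
  · rw [h, flagLE_zero_cons]
  · rfl

theorem sum_consBlock (m : ℕ) (L : List ℕ) : (consBlock m L).sum = m + L.sum := by
  unfold consBlock
  split_ifs with h <;> simp [h]

theorem pos_of_mem_consBlock {m : ℕ} {L : List ℕ} (hL : ∀ x ∈ L, 0 < x) :
    ∀ x ∈ consBlock m L, 0 < x := by
  unfold consBlock
  split_ifs with h
  · exact hL
  · simpa [Nat.pos_of_ne_zero h] using hL

/-- `SplitBlock a b`: the list `b` arises from `a` by replacing one entry `m + 2` by the entries
`1, m, 1`, or by `1, 1` if `m = 0`. -/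
inductive SplitBlock : List ℕ → List ℕ → Prop
  | head (m : ℕ) (t : List ℕ) : SplitBlock ((m + 2) :: t) (1 :: consBlock m (1 :: t))
  | cons (h : ℕ) {a b : List ℕ} : SplitBlock a b → SplitBlock (h :: a) (h :: b)

section

variable {K : Type*} [Field K]

theorem StabilizerBound.swap {a b : List ℕ} {n d : ℕ} (h : StabilizerBound K a b n d) :
    StabilizerBound K b a n d := by
  obtain ⟨F, hF⟩ := h
  refine ⟨F.transpose, ?_⟩
  rwa [← seaweedPattern_swap, finrank_patternStabilizer_transpose]

theorem StabilizerBound.mono {a b : List ℕ} {n d e : ℕ} (h : StabilizerBound K a b n d)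
    (hed : e ≤ d) : StabilizerBound K a b n e := by
  obtain ⟨F, hF⟩ := h
  exact ⟨F, by omega⟩

/-- Transport of an upper bound along `Fin s ⊕ Fin N ≃ Fin (s + N)`. -/
theorem StabilizerBound.of_sum {a b : List ℕ} {s N d : ℕ}
    (G : Matrix (Fin s ⊕ Fin N) (Fin s ⊕ Fin N) K)
    (hG : Module.finrank K (patternStabilizer (fun i j => seaweedPattern a b (s + N)
      (finSumFinEquiv i) (finSumFinEquiv j)) G) + d ≤ s + N) :
    StabilizerBound K a b (s + N) d := by
  refine ⟨G.submatrix finSumFinEquiv.symm finSumFinEquiv.symm, ?_⟩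
  rw [← finrank_patternStabilizer_reindex finSumFinEquiv]
  have : (G.submatrix finSumFinEquiv.symm finSumFinEquiv.symm).submatrix
      finSumFinEquiv finSumFinEquiv = G := by
    ext; simp
  rwa [this]

/-- Elimination of the first block `k` of `a` if the first block of `b` has size `2k + j`. This
lowers `n` by `k` without changing the index of the seaweed in `𝔤𝔩(n)`. -/
theorem StabilizerBound.eliminate {a b : List ℕ} {N d : ℕ} (k j : ℕ) (hN : j + k ≤ N)
    (h : StabilizerBound K a (consBlock j (k :: b)) N d) :
    StabilizerBound K (k :: a) ((2 * k + j) :: b) (k + N) (k + d) := by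
  obtain ⟨F, hF⟩ := h
  let l : Fin k → Fin N := fun i => ⟨j + i, by omega⟩
  refine StabilizerBound.of_sum (arcExtension l F) ?_
  have := finrank_patternStabilizer_arcExtension_le
    (fun i j' : Fin k ⊕ Fin N => seaweedPattern (k :: a) ((2 * k + j) :: b) (k + N)
      (finSumFinEquiv i) (finSumFinEquiv j'))
    (seaweedPattern a (consBlock j (k :: b)) N) l
    (fun x y h => by
      have := congrArg Fin.val h
      simp only [l] at this
      exact Fin.ext (by omega))
    (fun u => (u : ℕ) < j)
    (fun i => by simp [l])
    (fun i i' => ⟨flagLE_cons_of_lt _ _ (by simp),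
      flagLE_cons_of_lt _ _ (by simp; omega)⟩)
    ?_
    (fun u i h => not_flagLE_cons a (by simp) (by simp) h.1)
    ?_ ?_ F
  · omega
  · intro i u
    simp only [seaweedPattern, finSumFinEquiv_apply_left, finSumFinEquiv_apply_right,
      Fin.val_castAdd, Fin.val_natAdd]
    rw [flagLE_cons_iff_of_lt b (by omega)]
    constructor
    · rintro ⟨-, h⟩
      by_cases hu : (u : ℕ) < j
      · exact .inl hu
      · exact .inr ⟨⟨u - j, by omega⟩, Fin.ext (by simp only [l]; omega)⟩
    · intro h
      refine ⟨flagLE_of_le _ (by omega), ?_⟩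
      rcases h with h | ⟨b, rfl⟩
      · omega
      · simp only [l]; omega
  · intro u v
    have hl : (∃ b, v = l b) ↔ j ≤ (v : ℕ) ∧ (v : ℕ) < j + k := by
      constructor
      · rintro ⟨b, rfl⟩
        simp only [l]; omega
      · rintro ⟨h1, h2⟩
        exact ⟨⟨v - j, by omega⟩, Fin.ext (by simp only [l]; omega)⟩
    have h2 : 2 * k + j = k + (j + k) := by ring
    simp only [seaweedPattern, finSumFinEquiv_apply_right, Fin.val_natAdd]
    rw [h2, flagLE_consBlock, flagLE_cons_self_add, flagLE_cons_add, hl, and_assoc]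
    refine and_congr_right fun _ => ?_
    by_cases hu : (u : ℕ) < j
    · rw [flagLE_cons_iff_of_lt _ hu, flagLE_cons_iff_of_lt _ (by omega)]
      omega
    · by_cases hv : (v : ℕ) < j
      · exact iff_of_true (flagLE_cons_of_lt _ _ hv)
          ⟨flagLE_cons_of_lt _ _ (by omega), fun h => hu h.1⟩
      · obtain ⟨u', hu'⟩ := Nat.exists_eq_add_of_le (not_lt.mp hu)
        obtain ⟨v', hv'⟩ := Nat.exists_eq_add_of_le (not_lt.mp hv)
        rw [hu', hv', flagLE_cons_self_add, flagLE_cons_add]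
        exact ⟨fun h => ⟨h, by omega⟩, fun h => h.1⟩
  · intro u i hu
    simp only [seaweedPattern, finSumFinEquiv_apply_right, Fin.val_natAdd, l]
    exact ⟨flagLE_of_le _ (by omega), flagLE_cons_of_lt _ _ (by omega)⟩

variable [CharZero K]

theorem StabilizerBound.cons_cons {a b : List ℕ} {N d : ℕ} (k : ℕ) (h : StabilizerBound K a b N d) :
    StabilizerBound K (k :: a) (k :: b) (k + N) d := by
  obtain ⟨F, hF⟩ := h
  obtain ⟨G, hG⟩ := exists_finrank_patternStabilizer_le_card_add
    (fun i j : Fin k ⊕ Fin N => seaweedPattern (k :: a) (k :: b) (k + N)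
      (finSumFinEquiv i) (finSumFinEquiv j))
    (fun i j => ⟨flagLE_cons_of_lt _ _ (by simp), flagLE_cons_of_lt _ _ (by simp)⟩)
    (fun i j h => not_flagLE_cons b (by simp) (by simp) h.2)
    (fun i j h => not_flagLE_cons a (by simp) (by simp) h.1) F
  refine StabilizerBound.of_sum G ?_
  have hP : (fun u v : Fin N => seaweedPattern (k :: a) (k :: b) (k + N)
      (finSumFinEquiv (Sum.inr u : Fin k ⊕ Fin N)) (finSumFinEquiv (Sum.inr v : Fin k ⊕ Fin N))) =
      seaweedPattern a b N := by
    funext u v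
    simp [seaweedPattern, flagLE_cons_self_add]
  rw [hP, Fintype.card_fin] at hG
  omega

/-- Rotation of the first blocks, of sizes `s + e` and `2s + e`. This lowers `n` by `s` without
changing the index of the seaweed in `𝔤𝔩(n)`. -/
theorem StabilizerBound.rotate {a b : List ℕ} {N d : ℕ} (s e : ℕ) (hN : s + e ≤ N)
    (h : StabilizerBound K (e :: a) ((s + e) :: b) N d) :
    StabilizerBound K ((s + e) :: a) ((s + (s + e)) :: b) (s + N) (s + d) := by
  obtain ⟨F', hF'⟩ := h
  obtain ⟨F, hFF', hF, hFt⟩ := exists_patternStabilizer_block_invertible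
    (seaweedPattern (e :: a) ((s + e) :: b) N) (fun u => (u : ℕ) < e) F'
  let l : Fin s → Fin N := fun i => ⟨e + i, by omega⟩
  refine StabilizerBound.of_sum (arcExtension l F) ?_
  have := finrank_patternStabilizer_arcExtension_le_of_invertible
    (fun i j' : Fin s ⊕ Fin N => seaweedPattern ((s + e) :: a) ((s + (s + e)) :: b) (s + N)
      (finSumFinEquiv i) (finSumFinEquiv j')) l
    (fun x y h => by
      have := congrArg Fin.val h
      simp only [l] at this
      exact Fin.ext (by omega))
    (fun u => (u : ℕ) < e)
    (fun i => by simp [l])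
    (fun i i' => ⟨flagLE_cons_of_lt _ _ (by simp; omega),
      flagLE_cons_of_lt _ _ (by simp; omega)⟩)
    ?_
    ?_
    F hF hFt
  · have hP : (fun u v : Fin N => seaweedPattern ((s + e) :: a) ((s + (s + e)) :: b) (s + N)
      (finSumFinEquiv (Sum.inr u : Fin s ⊕ Fin N)) (finSumFinEquiv (Sum.inr v : Fin s ⊕ Fin N))) =
      seaweedPattern (e :: a) ((s + e) :: b) N := by
      funext u v
      simp [seaweedPattern, flagLE_cons_add]
    rw [hP] at this
    omega
  · intro i u
    simp only [seaweedPattern, finSumFinEquiv_apply_left, finSumFinEquiv_apply_right,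
      Fin.val_castAdd, Fin.val_natAdd]
    rw [flagLE_cons_iff_of_lt b (by omega)]
    constructor
    · rintro ⟨-, h⟩
      by_cases hu : (u : ℕ) < e
      · exact .inl hu
      · exact .inr ⟨⟨u - e, by omega⟩, Fin.ext (by simp only [l]; omega)⟩
    · intro h
      refine ⟨flagLE_of_le _ (by omega), ?_⟩
      rcases h with h | ⟨b, rfl⟩
      · omega
      · simp only [l]; omega
  · intro u i
    simp only [seaweedPattern, finSumFinEquiv_apply_left, finSumFinEquiv_apply_right,
      Fin.val_castAdd, Fin.val_natAdd]
    rw [flagLE_cons_iff_of_lt a (by omega)]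
    exact ⟨fun h => by omega, fun h => ⟨by omega, flagLE_of_le _ (by omega)⟩⟩

/-- The lists `a` and `b` are the sequences of parts of two compositions of `n`. -/
structure CompositionPair (a b : List ℕ) (n : ℕ) : Prop where
  pos_left : ∀ x ∈ a, 0 < x
  pos_right : ∀ x ∈ b, 0 < x
  sum_left : a.sum = n
  sum_right : b.sum = n

theorem CompositionPair.swap {a b : List ℕ} {n : ℕ} (h : CompositionPair a b n) :
    CompositionPair b a n :=
  ⟨h.2, h.1, h.4, h.3⟩

/-- The inductive step of the upper bounds, for first blocks of sizes `k < m`. Elimination and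
rotation lower `n` by at least one, and by exactly one only for `k = 1` or `m = k + 1`. -/
theorem stabilizerBound_of_head_lt {a b : List ℕ} {n k m : ℕ}
    (ih : ∀ N < n, ∀ a b : List ℕ, CompositionPair a b N →
      StabilizerBound K a b N 0 ∧ (a ≠ b → StabilizerBound K a b N 1))
    (h : CompositionPair (k :: a) (m :: b) n) (hkm : k < m) :
    StabilizerBound K (k :: a) (m :: b) n 1 ∧
      (¬ SplitBlock (m :: b) (k :: a) → StabilizerBound K (k :: a) (m :: b) n 2) := by
  obtain ⟨h1, h2, h3, h4⟩ := h
  simp only [List.forall_mem_cons, List.sum_cons] at h1 h2 h3 h4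
  obtain ⟨N, hN⟩ : ∃ N, N = a.sum := ⟨_, rfl⟩
  rcases le_or_gt (2 * k) m with hm | hm
  · obtain ⟨j, rfl⟩ := Nat.exists_eq_add_of_le hm
    obtain rfl : n = k + N := by omega
    have hpair : CompositionPair a (consBlock j (k :: b)) N :=
      ⟨h1.2, pos_of_mem_consBlock (by simpa using ⟨h1.1, h2.2⟩), hN.symm, by
        rw [sum_consBlock, List.sum_cons]; omega⟩
    obtain ⟨i1, i2⟩ := ih N (by omega) _ _ hpair
    have e1 := i1.eliminate k j (by omega)
    refine ⟨e1.mono (by omega), fun hs => ?_⟩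
    by_cases hk : k = 1
    · subst hk
      -- the reduced pair can only consist of equal lists if a block was split
      have hne : a ≠ consBlock j (1 :: b) := by
        rintro rfl
        apply hs
        rw [mul_one, add_comm 2 j]
        exact SplitBlock.head j b
      exact (i2 hne).eliminate 1 j (by omega)
    · exact e1.mono (by omega)
  · obtain ⟨s, rfl⟩ := Nat.exists_eq_add_of_le' hkm.le
    obtain ⟨e, rfl⟩ := Nat.exists_eq_add_of_le (show s ≤ k by omega)
    obtain ⟨N', hN'⟩ : ∃ N', n = s + N' := Nat.exists_eq_add_of_le (by omega)
    subst hN'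
    have hpair : CompositionPair (e :: a) ((s + e) :: b) N' :=
      ⟨by simp only [List.forall_mem_cons]; exact ⟨by omega, h1.2⟩,
        by simp only [List.forall_mem_cons]; exact ⟨by omega, h2.2⟩,
        by rw [List.sum_cons]; omega, by rw [List.sum_cons]; omega⟩
    obtain ⟨-, i2⟩ := ih N' (by omega) _ _ hpair
    -- the reduced pair consists of different lists, which gains one more dimension
    have hne : e :: a ≠ (s + e) :: b := by
      intro h
      have := (List.cons.inj h).1
      omega
    have e1 := (i2 hne).rotate s e (by omega)
    exact ⟨e1.mono (by omega), fun _ => e1.mono (by omega)⟩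

/-- A seaweed of type `a | b` in `𝔤𝔩(n)` has index at most `n`, at most `n - 1` if `a ≠ b`, and at
most `n - 2` if moreover neither composition splits a block of the other one. -/
theorem stabilizerBound (n : ℕ) : ∀ a b : List ℕ, CompositionPair a b n →
    StabilizerBound K a b n 0 ∧ (a ≠ b → StabilizerBound K a b n 1) ∧
      (a ≠ b → ¬ SplitBlock a b → ¬ SplitBlock b a → StabilizerBound K a b n 2) := by
  induction n using Nat.strong_induction_on with
  | _ n ih =>
    have ih' : ∀ N < n, ∀ a b : List ℕ, CompositionPair a b N →
        StabilizerBound K a b N 0 ∧ (a ≠ b → StabilizerBound K a b N 1) :=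
      fun N hN a b h => ⟨(ih N hN a b h).1, (ih N hN a b h).2.1⟩
    rintro (_ | ⟨k, a⟩) (_ | ⟨m, b⟩) h
    · obtain rfl : 0 = n := h.sum_left
      refine ⟨⟨0, ?_⟩, fun h => absurd rfl h, fun h => absurd rfl h⟩
      have : Subsingleton (patternStabilizer (seaweedPattern [] [] 0) (0 : Matrix _ _ K)) :=
        ⟨fun x y => Subtype.ext (Subsingleton.elim _ _)⟩
      rw [Module.finrank_zero_of_subsingleton]
    · have h1 := h.pos_right m (by simp)
      have h2 := h.sum_left
      have h3 := h.sum_right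
      simp at h2 h3
      omega
    · have h1 := h.pos_left k (by simp)
      have h2 := h.sum_left
      have h3 := h.sum_right
      simp at h2 h3
      omega
    · rcases lt_trichotomy k m with hkm | rfl | hkm
      · obtain ⟨e1, e2⟩ := stabilizerBound_of_head_lt ih' h hkm
        exact ⟨e1.mono (by omega), fun _ => e1, fun _ _ hs => e2 hs⟩
      · have h1 := h.pos_left k (by simp)
        have h3 := h.sum_left
        have h4 := h.sum_right
        have h5 := h.pos_left
        have h6 := h.pos_right
        simp only [List.forall_mem_cons, List.sum_cons] at h3 h4 h5 h6
        obtain ⟨N, rfl⟩ := Nat.exists_eq_add_of_le (show k ≤ n by omega)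
        obtain ⟨i0, i1, i2⟩ := ih N (by omega) a b
          ⟨h5.2, h6.2, by omega, by omega⟩
        refine ⟨i0.cons_cons k, fun hne => (i1 ?_).cons_cons k,
          fun hne hs hs' => (i2 ?_ ?_ ?_).cons_cons k⟩
        · rintro rfl; exact hne rfl
        · rintro rfl; exact hne rfl
        · exact fun h => hs (.cons k h)
        · exact fun h => hs' (.cons k h)
      · obtain ⟨e1, e2⟩ := stabilizerBound_of_head_lt ih' h.swap hkm
        exact ⟨(e1.mono (by omega)).swap, fun _ => e1.swap, fun _ hs _ => (e2 hs).swap⟩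

end

/-! ### Lower bounds -/

/-- The relation obtained from an equivalence relation `r` by removing the off-diagonal
positions in the row of `i` and in the column of `j`. -/
def cutPattern {ι : Type*} (r : ι → ι → Prop) (i j k l : ι) : Prop :=
  r k l ∧ (k = i → l = i) ∧ (l = j → k = j)

theorem cutPattern.trans {ι : Type*} {r : ι → ι → Prop} (hr : Equivalence r) {i j k l m : ι}
    (h : cutPattern r i j k l) (h' : cutPattern r i j l m) : cutPattern r i j k m :=
  ⟨hr.trans h.1 h'.1, fun hk => h'.2.1 (h.2.1 hk), fun hm => h.2.2 (h'.2.2 hm)⟩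

section

variable {K ι : Type*} [Field K] [Fintype ι]

/-- On the line through `F` and a diagonal matrix with distinct entries, all but finitely many
matrices are cyclic. -/
theorem finite_setOf_not_linearIndependent_pow [DecidableEq ι] (F : Matrix ι ι K) {d : ι → K}
    (hd : Function.Injective d) :
    {t : K | ¬ LinearIndependent K (fun p : Fin (Fintype.card ι) =>
      (F + t • (Matrix.diagonal d - F)) ^ (p : ℕ))}.Finite := by
  classical
  let e := Fintype.equivFin ι
  -- the rows of `W t` are the images of the vector `(1, …, 1)` under the powers
  let W : K → Matrix (Fin (Fintype.card ι)) (Fin (Fintype.card ι)) K := fun t =>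
    Matrix.of fun p q => ∑ w, ((F + t • (Matrix.diagonal d - F)) ^ (p : ℕ)) (e.symm q) w
  let G : Matrix ι ι (Polynomial K) :=
    (F.map (Polynomial.C : K →+* Polynomial K)) +
      (Polynomial.X : Polynomial K) • ((Matrix.diagonal d - F).map (Polynomial.C : K →+* _))
  let V : Matrix (Fin (Fintype.card ι)) (Fin (Fintype.card ι)) (Polynomial K) :=
    Matrix.of fun p q => ∑ w, (G ^ (p : ℕ)) (e.symm q) w
  have hG : ∀ t, G.map (Polynomial.evalRingHom t) = F + t • (Matrix.diagonal d - F) := by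
    intro t
    ext k l
    simp [G]
  have hV : ∀ t, V.map (Polynomial.evalRingHom t) = W t := by
    intro t
    ext p q
    simp only [V, W, Matrix.map_apply, Matrix.of_apply, map_sum, ← hG]
    refine Finset.sum_congr rfl fun w _ => ?_
    rw [← Matrix.map_pow]
    rfl
  have hdet : ∀ t, (V.det).eval t = (W t).det := by
    intro t
    rw [← hV, ← Polynomial.coe_evalRingHom, RingHom.map_det]
    rfl
  have h1 : (W 1).det ≠ 0 := by
    have : W 1 = (Matrix.vandermonde (fun q => d (e.symm q))).transpose := by
      ext p q
      simp [W, Matrix.diagonal_pow, Matrix.vandermonde, Matrix.diagonal_apply]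
    rw [this, Matrix.det_transpose, Matrix.det_vandermonde_ne_zero_iff]
    exact hd.comp e.symm.injective
  have hV0 : V.det ≠ 0 := by
    intro h
    rw [← hdet, h] at h1
    simp at h1
  refine (V.det.roots.toFinset.finite_toSet).subset fun t ht => ?_
  rw [Finset.mem_coe, Multiset.mem_toFinset, Polynomial.mem_roots hV0, Polynomial.IsRoot, hdet]
  by_contra hne
  apply ht
  have hrow := Matrix.linearIndependent_rows_of_det_ne_zero hne
  let f : Matrix ι ι K →ₗ[K] (Fin (Fintype.card ι) → K) :=
    { toFun := fun x q => ∑ w, x (e.symm q) w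
      map_add' := fun x y => by ext q; simp [Finset.sum_add_distrib]
      map_smul' := fun c x => by ext q; simp [Finset.mul_sum] }
  exact LinearIndependent.of_comp f hrow

open Classical in
/-- Only the entries of `F` in the transposed pattern matter. -/
theorem patternStabilizer_mask {P : ι → ι → Prop} (hP : ∀ i j k, P i j → P j k → P i k)
    (F : Matrix ι ι K) :
    patternStabilizer P (Matrix.of fun j k => if P k j then F j k else 0) =
      patternStabilizer P F := by
  ext x
  rw [mem_patternStabilizer, mem_patternStabilizer]
  refine and_congr_right fun hx => forall₂_congr fun i j => imp_congr_right fun hij => ?_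
  rw [Matrix.sub_apply, Matrix.sub_apply, Matrix.mul_apply, Matrix.mul_apply, Matrix.mul_apply,
    Matrix.mul_apply]
  have h1 : ∀ k, (Matrix.of fun j k => if P k j then F j k else 0) j k * x k i =
      F j k * x k i := by
    intro k
    by_cases h : P k i
    · rw [Matrix.of_apply, if_pos (hP _ _ _ h hij)]
    · rw [hx _ _ h, mul_zero, mul_zero]
  have h2 : ∀ k, x j k * (Matrix.of fun j k => if P k j then F j k else 0) k i =
      x j k * F k i := by
    intro k
    by_cases h : P j k
    · rw [Matrix.of_apply, if_pos (hP _ _ _ hij h)]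
    · rw [hx _ _ h, zero_mul, zero_mul]
  simp only [h1, h2]

/-- Block diagonal matrices are closed under powers. -/
theorem pow_apply_eq_zero [DecidableEq ι] {r : ι → ι → Prop} (hr : Equivalence r)
    {G : Matrix ι ι K} (hG : ∀ k l, ¬ r k l → G k l = 0) (p : ℕ) :
    ∀ k l, ¬ r k l → (G ^ p) k l = 0 := by
  induction p with
  | zero =>
    intro k l h
    rw [pow_zero, Matrix.one_apply_ne]
    rintro rfl
    exact h (hr.refl k)
  | succ p ih =>
    intro k l h
    rw [pow_succ, Matrix.mul_apply]
    refine Finset.sum_eq_zero fun w _ => ?_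
    by_cases h1 : r k w
    · rw [hG w l fun h2 => h (hr.trans h1 h2), mul_zero]
    · rw [ih k w h1, zero_mul]

/-- The index of a Levi subalgebra of `𝔤𝔩(n)` is at least `n`: a form given by a cyclic matrix is
stabilized by the powers of that matrix, and other forms are limits of such forms. -/
theorem card_le_finrank_patternStabilizer [CharZero K] {r : ι → ι → Prop} (hr : Equivalence r)
    (F : Matrix ι ι K) : Fintype.card ι ≤ Module.finrank K (patternStabilizer r F) := by
  classical
  rw [← patternStabilizer_mask (P := r) fun i j k => hr.trans]
  set G : Matrix ι ι K := Matrix.of fun j k => if r k j then F j k else 0 with hGdef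
  have hG : ∀ k l, ¬ r k l → G k l = 0 := fun k l h => by
    rw [hGdef, Matrix.of_apply, if_neg fun h' => h (hr.symm h')]
  let d : ι → K := fun a => ((Fintype.equivFin ι a : ℕ) : K)
  have hd : Function.Injective d := fun a b h =>
    (Fintype.equivFin ι).injective (Fin.ext (Nat.cast_injective h))
  obtain ⟨t, ht⟩ := ((finite_setOf_not_linearIndependent_pow G hd).union
    (finite_setOf_finrank_patternStabilizer_lt r G (Matrix.diagonal d - G))).exists_notMem
  simp only [Set.mem_union, Set.mem_ofPred_eq, not_or, not_not] at ht
  refine le_trans ?_ ht.2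
  set E := G + t • (Matrix.diagonal d - G) with hE
  have hE0 : ∀ k l, ¬ r k l → E k l = 0 := by
    intro k l h
    have hkl : k ≠ l := by rintro rfl; exact h (hr.refl k)
    simp [hE, hG k l h, hkl]
  have hmem : ∀ p : Fin (Fintype.card ι), E ^ (p : ℕ) ∈ patternStabilizer r E := fun p =>
    ⟨pow_apply_eq_zero hr hE0 p, fun i j _ => by rw [← pow_succ, ← pow_succ', sub_self]; rfl⟩
  have hli : LinearIndependent K (fun p : Fin (Fintype.card ι) =>
      (⟨E ^ (p : ℕ), hmem p⟩ : patternStabilizer r E)) :=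
    LinearIndependent.of_comp (patternStabilizer r E).subtype ht.1
  simpa using hli.fintype_card_le_finrank

/-- The Schur complement of the entry `F i j`. It is meaningful if `F i j ≠ 0`. -/
def entrySchur (F : Matrix ι ι K) (i j : ι) :
    Matrix {k // k ≠ i ∧ k ≠ j} {k // k ≠ i ∧ k ≠ j} K :=
  Matrix.of fun k l => F k l - F k j * F i l / F i j

/-- If `F i j ≠ 0` and the Schur complement `G` of this entry is cyclic, then the stabilizer
contains the scalar matrices and the matrices `R * G ^ p * S`, where the columns of `R` are annihilated by
row `i` of `F`, and the rows of `S` by column `j` of `F`. -/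
theorem card_le_finrank_cutPattern_of_linearIndependent [DecidableEq ι] {r : ι → ι → Prop}
    (hr : Equivalence r) {i j : ι} (hij : i ≠ j) (hrij : r i j) {F : Matrix ι ι K}
    (hF : ∀ k l, ¬ cutPattern r i j l k → F k l = 0) (hα : F i j ≠ 0)
    (hli : LinearIndependent K
      (fun p : Fin (Fintype.card {k // k ≠ i ∧ k ≠ j}) => entrySchur F i j ^ (p : ℕ))) :
    Fintype.card ι ≤ Module.finrank K (patternStabilizer (cutPattern r i j) F) + 1 := by
  set G := entrySchur F i j with hGdef
  let R : Matrix ι {k // k ≠ i ∧ k ≠ j} K := Matrix.of fun k w =>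
    if k = j then -(F i w / F i j) else if k = w then 1 else 0
  let S : Matrix {k // k ≠ i ∧ k ≠ j} ι K := Matrix.of fun z l =>
    if l = i then -(F z j / F i j) else if l = z then 1 else 0
  have hFr : ∀ k l, ¬ r k l → F k l = 0 := fun k l h =>
    hF k l fun h' => h (hr.symm h'.1)
  have hGr : ∀ k l : {k // k ≠ i ∧ k ≠ j}, ¬ r k l → G k l = 0 := by
    intro k l h
    have h1 : F k j * F i l = 0 := by
      by_cases h1 : r k j
      · rw [hFr i l fun h2 => h (hr.trans (hr.trans h1 (hr.symm hrij)) h2), mul_zero]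
      · rw [hFr _ _ h1, zero_mul]
    simp [hGdef, entrySchur, hFr _ _ h, h1]
  have hRr : ∀ k w, ¬ r k (w : {k // k ≠ i ∧ k ≠ j}) → R k w = 0 := by
    intro k w h
    by_cases hk : k = j
    · subst hk
      simp [R, hFr i w fun h2 => h (hr.trans (hr.symm hrij) h2)]
    · have : k ≠ w := by rintro rfl; exact h (hr.refl _)
      simp [R, hk, this]
  have hSr : ∀ (z : {k // k ≠ i ∧ k ≠ j}) l, ¬ r z l → S z l = 0 := by
    intro z l h
    by_cases hl : l = i
    · subst hl
      simp [S, hFr z j fun h2 => h (hr.trans h2 (hr.symm hrij))]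
    · have : l ≠ z := by rintro rfl; exact h (hr.refl _)
      simp [S, hl, this]
  have hRi : ∀ w, R i w = 0 := fun w => by simp [R, hij, w.2.1.symm]
  have hSj : ∀ z, S z j = 0 := fun z => by simp [S, hij.symm, z.2.2.symm]
  have hRκ : ∀ k w : {k // k ≠ i ∧ k ≠ j}, R k w = (1 : Matrix _ _ K) k w := fun k w => by
    simp [R, k.2.2, Matrix.one_apply, Subtype.ext_iff]
  have hSκ : ∀ z l : {k // k ≠ i ∧ k ≠ j}, S z l = (1 : Matrix _ _ K) z l := fun z l => by
    simp [S, l.2.1, Matrix.one_apply, Subtype.ext_iff, eq_comm (a := (l : ι))]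
  have hFR : ∀ k w, (F * R) k w = F k w - F k j * F i w / F i j := by
    intro k w
    have h1 : ∀ q, F k q * R q w =
        (if q = j then -(F k j * F i w / F i j) else 0) + if q = w then F k w else 0 := by
      intro q
      by_cases hq : q = j
      · subst hq
        simp [R, w.2.2.symm]
        ring
      · by_cases hqw : q = w
        · subst hqw; simp [R, hq]
        · simp [R, hq, hqw]
    simp only [Matrix.mul_apply, h1, Finset.sum_add_distrib, Finset.sum_ite_eq', Finset.mem_univ,
      if_true]
    ring
  have hSF : ∀ z l, (S * F) z l = F z l - F z j * F i l / F i j := by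
    intro z l
    have h1 : ∀ q, S z q * F q l =
        (if q = i then -(F z j * F i l / F i j) else 0) + if q = z then F z l else 0 := by
      intro q
      by_cases hq : q = i
      · subst hq
        simp [S, z.2.1.symm]
        ring
      · by_cases hqz : q = z
        · subst hqz; simp [S, hq]
        · simp [S, hq, hqz]
    simp only [Matrix.mul_apply, h1, Finset.sum_add_distrib, Finset.sum_ite_eq', Finset.mem_univ,
      if_true]
    ring
  -- `R M S` restricts to `M` away from `i` and `j`
  have hblock : ∀ M : Matrix {k // k ≠ i ∧ k ≠ j} {k // k ≠ i ∧ k ≠ j} K,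
      ∀ k l : {k // k ≠ i ∧ k ≠ j}, (R * M * S) k l = M k l := by
    intro M k l
    simp only [Matrix.mul_apply, hRκ, hSκ]
    simp [Matrix.one_apply]
  have hmem : ∀ p : ℕ, R * G ^ p * S ∈ patternStabilizer (cutPattern r i j) F := by
    intro p
    have hGp := pow_apply_eq_zero (r := fun k l : {k // k ≠ i ∧ k ≠ j} => r k l)
      ⟨fun _ => hr.refl _, hr.symm, hr.trans⟩ hGr p
    constructor
    · intro k l h
      by_cases hki : k = i
      · subst hki
        simp [Matrix.mul_apply, hRi]
      by_cases hlj : l = j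
      · subst hlj
        simp [Matrix.mul_apply, hSj]
      have hkl : ¬ r k l := fun h' => h ⟨h', fun h => absurd h hki, fun h => absurd h hlj⟩
      rw [Matrix.mul_apply]
      refine Finset.sum_eq_zero fun z _ => ?_
      by_cases hz : r z l
      · rw [Matrix.mul_apply, Finset.sum_eq_zero, zero_mul]
        intro w _
        by_cases hw : r k w
        · rw [hGp w z fun h' => hkl (hr.trans hw (hr.trans h' hz)), mul_zero]
        · rw [hRr k w hw, zero_mul]
      · rw [hSr z l hz, mul_zero]
    · intro k l h
      have h1 : F * (R * G ^ p * S) = (F * R) * G ^ p * S := by simp only [Matrix.mul_assoc]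
      have h2 : R * G ^ p * S * F = R * G ^ p * (S * F) := by simp only [Matrix.mul_assoc]
      rw [h1, h2, Matrix.sub_apply]
      by_cases hli : l = i
      · subst hli
        simp [Matrix.mul_apply (M := F * R * G ^ p), Matrix.mul_apply (M := F * R),
          Matrix.mul_apply (M := R * G ^ p), Matrix.mul_apply (M := R), hFR, hRi,
          mul_div_cancel_left₀ _ hα]
      by_cases hkj : k = j
      · subst hkj
        simp [Matrix.mul_apply (M := F * R * G ^ p),
          Matrix.mul_apply (M := R * G ^ p), hSF, hSj, hα]
      have hki : k ≠ i := fun h' => hli (h.2.1 h')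
      have hlj : l ≠ j := fun h' => hkj (h.2.2 h')
      have e1 : (F * R * G ^ p * S) l k = (G * G ^ p) ⟨l, hli, hlj⟩ ⟨k, hki, hkj⟩ := by
        rw [Matrix.mul_apply]
        simp only [fun z => hSκ z ⟨k, hki, hkj⟩]
        simp only [Matrix.mul_apply, hFR, Matrix.one_apply]
        simp [hGdef, entrySchur]
      have e2 : (R * G ^ p * (S * F)) l k = (G ^ p * G) ⟨l, hli, hlj⟩ ⟨k, hki, hkj⟩ := by
        rw [Matrix.mul_assoc, Matrix.mul_apply]
        simp only [fun z => hRκ ⟨l, hli, hlj⟩ z]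
        simp only [Matrix.mul_apply, hSF, Matrix.one_apply]
        simp [hGdef, entrySchur]
      rw [e1, e2, ← pow_succ, ← pow_succ', sub_self]
  have hone : (1 : Matrix ι ι K) ∈ patternStabilizer (cutPattern r i j) F := by
    refine ⟨fun k l h => Matrix.one_apply_ne ?_, fun k l _ => by simp⟩
    rintro rfl
    exact h ⟨hr.refl _, id, id⟩
  let φ : (K × (Fin (Fintype.card {k // k ≠ i ∧ k ≠ j}) → K)) →ₗ[K]
      patternStabilizer (cutPattern r i j) F :=
    { toFun := fun c => c.1 • ⟨1, hone⟩ + ∑ p, c.2 p • ⟨R * G ^ (p : ℕ) * S, hmem p⟩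
      map_add' := fun c c' => by
        simp only [Prod.fst_add, Prod.snd_add, Pi.add_apply, add_smul, Finset.sum_add_distrib]
        abel
      map_smul' := fun c c' => by
        simp only [Prod.smul_fst, Prod.smul_snd, Pi.smul_apply, smul_eq_mul, mul_smul, smul_add,
          Finset.smul_sum, RingHom.id_apply] }
  have hφ : Function.Injective φ := by
    rw [← LinearMap.ker_eq_bot, LinearMap.ker_eq_bot']
    rintro ⟨a, c⟩ h
    have h1 : a • (1 : Matrix ι ι K) + ∑ p, c p • (R * G ^ (p : ℕ) * S) = 0 := by
      have := congrArg Subtype.val h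
      simpa [φ] using this
    have ha : a = 0 := by
      have := congrFun (congrFun h1 i) i
      simpa [Matrix.sum_apply, Matrix.mul_apply, hRi] using this
    subst ha
    have h2 : ∑ p, c p • G ^ (p : ℕ) = 0 := by
      ext k l
      have := congrFun (congrFun h1 k) l
      simpa [Matrix.sum_apply, hblock] using this
    have hc : c = 0 := funext (Fintype.linearIndependent_iff.mp hli c h2)
    rw [hc]
    rfl
  have hfin := LinearMap.finrank_le_finrank_of_injective hφ
  rw [Module.finrank_prod, Module.finrank_self, Module.finrank_fintype_fun_eq_card,
    Fintype.card_fin] at hfin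
  have hcard : Fintype.card {k // k ≠ i ∧ k ≠ j} + 2 = Fintype.card ι := by
    have h1 : Fintype.card {k // k ≠ i ∧ k ≠ j} = (({i, j} : Finset ι)ᶜ).card := by
      rw [Fintype.card_subtype]
      congr 1
      ext k
      simp
    rw [h1, Finset.card_compl, Finset.card_pair hij]
    have : ({i, j} : Finset ι).card ≤ Fintype.card ι := Finset.card_le_univ _
    rw [Finset.card_pair hij] at this
    omega
  omega

/-- The bound for an arbitrary form, obtained by perturbing it into one with `F i j ≠ 0` and cyclic
Schur complement. -/
theorem card_le_finrank_cutPattern [CharZero K] {r : ι → ι → Prop}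
    (hr : Equivalence r) {i j : ι} (hij : i ≠ j) (hrij : r i j) (F : Matrix ι ι K) :
    Fintype.card ι ≤ Module.finrank K (patternStabilizer (cutPattern r i j) F) + 1 := by
  classical
  have main : ∀ F : Matrix ι ι K, F i j ≠ 0 →
      Fintype.card ι ≤ Module.finrank K (patternStabilizer (cutPattern r i j) F) + 1 := by
    intro F hα
    rw [← patternStabilizer_mask (P := cutPattern r i j) fun _ _ _ => cutPattern.trans hr]
    set G : Matrix ι ι K := Matrix.of fun k l => if cutPattern r i j l k then F k l else 0
      with hGdef
    have hG : ∀ k l, ¬ cutPattern r i j l k → G k l = 0 := fun k l h => by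
      rw [hGdef, Matrix.of_apply, if_neg h]
    have hGij : G i j = F i j := by
      rw [hGdef, Matrix.of_apply, if_pos ⟨hr.symm hrij, fun h => absurd h.symm hij,
        fun h => absurd h hij⟩]
    have hGr : ∀ k l, ¬ r k l → G k l = 0 := fun k l h => hG k l fun h' => h (hr.symm h'.1)
    let d : {k // k ≠ i ∧ k ≠ j} → K := fun a => ((Fintype.equivFin _ a : ℕ) : K)
    have hd : Function.Injective d := fun a b h =>
      (Fintype.equivFin _).injective (Fin.ext (Nat.cast_injective h))
    -- perturb the Schur complement towards a diagonal matrix with distinct entries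
    let H : Matrix ι ι K := Matrix.of fun k l => if h : (k ≠ i ∧ k ≠ j) ∧ (l ≠ i ∧ l ≠ j) then
      (Matrix.diagonal d - entrySchur G i j) ⟨k, h.1⟩ ⟨l, h.2⟩ else 0
    obtain ⟨t, ht⟩ := ((finite_setOf_not_linearIndependent_pow (entrySchur G i j) hd).union
      (finite_setOf_finrank_patternStabilizer_lt (cutPattern r i j) G H)).exists_notMem
    simp only [Set.mem_union, Set.mem_ofPred_eq, not_or, not_not] at ht
    have hH : ∀ k l, ¬ cutPattern r i j l k → H k l = 0 := by
      intro k l h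
      by_cases hkl : (k ≠ i ∧ k ≠ j) ∧ (l ≠ i ∧ l ≠ j)
      · have hr' : ¬ r k l := fun h' => h ⟨hr.symm h', fun h => absurd h hkl.2.1,
          fun h => absurd h hkl.1.2⟩
        have hne : k ≠ l := by rintro rfl; exact hr' (hr.refl _)
        have h1 : G k j * G i l = 0 := by
          by_cases h1 : r k j
          · rw [hGr i l fun h2 => hr' (hr.trans (hr.trans h1 (hr.symm hrij)) h2), mul_zero]
          · rw [hGr _ _ h1, zero_mul]
        simp [H, hkl, entrySchur, hne, hGr _ _ hr', h1]
      · simp [H, hkl]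
    have hHrow : ∀ l, H i l = 0 := fun l => by simp [H]
    have hHcol : ∀ k, H k j = 0 := fun k => by simp [H]
    have hschur : entrySchur (G + t • H) i j =
        entrySchur G i j + t • (Matrix.diagonal d - entrySchur G i j) := by
      ext k l
      have : H k l = (Matrix.diagonal d - entrySchur G i j) k l := by
        simp [H, k.2.1, k.2.2, l.2.1, l.2.2]
      simp only [entrySchur, Matrix.of_apply, Matrix.add_apply, Matrix.smul_apply, hHrow, hHcol,
        this, smul_zero, add_zero]
      ring
    have := card_le_finrank_cutPattern_of_linearIndependent hr hij hrij (F := G + t • H)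
      (fun k l h => by simp [hG k l h, hH k l h]) (by simpa [hHrow, hGij] using hα)
      (by rw [hschur]; exact ht.1)
    have := ht.2
    omega
  obtain ⟨t, ht⟩ := ((finite_setOf_finrank_patternStabilizer_lt (cutPattern r i j) F
    (Matrix.single i j 1)).union (Set.finite_singleton (-F i j))).exists_notMem
  simp only [Set.mem_union, Set.mem_ofPred_eq, Set.mem_singleton_iff, not_or, not_not] at ht
  have h1 := main (F + t • Matrix.single i j 1) (by
    intro h
    apply ht.2
    simp at h
    linear_combination h)
  have := ht.1
  omega

end

/-! ### The pattern of a split block -/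

theorem SplitBlock.length_lt {a b : List ℕ} (h : SplitBlock a b) : a.length < b.length := by
  induction h with
  | head m t =>
    unfold consBlock
    split_ifs <;> simp
  | cons h _ ih => simpa using ih

theorem SplitBlock.ne {a b : List ℕ} (h : SplitBlock a b) : a ≠ b := by
  rintro rfl
  exact lt_irrefl _ h.length_lt

/-- Splitting the block from `i` to `j` of `a` removes the off-diagonal positions in row `i` and in
column `j` from the Levi pattern of `a`. -/
theorem SplitBlock.exists_cut {a b : List ℕ} (h : SplitBlock a b) :
    ∃ i j, i < j ∧ j < a.sum ∧ FlagLE a j i ∧ ∀ k l, FlagLE a k l ∧ FlagLE b l k ↔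
      (FlagLE a k l ∧ FlagLE a l k) ∧ (k = i → l = i) ∧ (l = j → k = j) := by
  induction h with
  | head m t =>
    refine ⟨0, m + 1, by omega, by rw [List.sum_cons]; omega,
      flagLE_cons_of_lt _ _ (by omega), fun k l => ?_⟩
    rw [and_assoc]
    refine and_congr_right fun hkl => ?_
    have hb : ∀ l k, FlagLE (1 :: consBlock m (1 :: t)) (1 + l) (1 + k) ↔
        FlagLE (m :: 1 :: t) l k := fun l k => by
      rw [flagLE_cons_self_add, flagLE_consBlock]
    rcases Nat.eq_zero_or_pos k with rfl | hk
    · rw [flagLE_cons_iff_of_lt _ (by omega), flagLE_cons_iff_of_lt _ (by omega)]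
      omega
    rcases Nat.eq_zero_or_pos l with rfl | hl
    · exact iff_of_true (flagLE_of_le _ hk.le)
        ⟨flagLE_of_le _ hk.le, by omega, by omega⟩
    obtain ⟨k, rfl⟩ := Nat.exists_eq_add_of_le hk
    obtain ⟨l, rfl⟩ := Nat.exists_eq_add_of_le hl
    rw [Nat.succ_eq_add_one, zero_add] at *
    rw [hb]
    rcases lt_or_ge k m with hkm | hkm
    · rw [flagLE_cons_iff_of_lt _ hkm, flagLE_cons_iff_of_lt _ (by omega)]
      omega
    obtain ⟨k, rfl⟩ := Nat.exists_eq_add_of_le hkm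
    rcases lt_or_ge l m with hlm | hlm
    · exact iff_of_true (flagLE_of_le _ (by omega))
        ⟨flagLE_of_le _ (by omega), by omega, by omega⟩
    obtain ⟨l, rfl⟩ := Nat.exists_eq_add_of_le hlm
    rw [flagLE_cons_self_add]
    rcases Nat.eq_zero_or_pos k with rfl | hk'
    · rw [flagLE_cons_iff_of_lt _ (by omega), flagLE_cons_iff_of_lt _ (by omega)]
      omega
    rcases Nat.eq_zero_or_pos l with rfl | hl'
    · exact absurd hkl (not_flagLE_cons _ (by omega) (by omega))
    obtain ⟨k, rfl⟩ := Nat.exists_eq_add_of_le hk'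
    obtain ⟨l, rfl⟩ := Nat.exists_eq_add_of_le hl'
    rw [Nat.succ_eq_add_one, zero_add, flagLE_cons_self_add]
    have e : ∀ x, 1 + (m + (1 + x)) = m + 2 + x := fun x => by ring
    rw [e, e, flagLE_cons_self_add]
    exact ⟨fun h => ⟨h, by omega, by omega⟩, fun h => h.1⟩
  | @cons h a b _ ih =>
    obtain ⟨i, j, hij, hj, hji, H⟩ := ih
    refine ⟨h + i, h + j, by omega, by simpa using hj, (flagLE_cons_self_add _ _ _ _).2 hji,
      fun k l => ?_⟩
    rcases lt_or_ge k h with hk | hk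
    · rw [flagLE_cons_iff_of_lt b hk, and_assoc, flagLE_cons_iff_of_lt a hk]
      refine and_congr_right fun _ => ?_
      omega
    obtain ⟨k, rfl⟩ := Nat.exists_eq_add_of_le hk
    rcases lt_or_ge l h with hl | hl
    · have := not_flagLE_cons a hk hl
      exact iff_of_false (fun h => this h.1) (fun h => this h.1.1)
    obtain ⟨l, rfl⟩ := Nat.exists_eq_add_of_le hl
    simp only [flagLE_cons_self_add, add_right_inj]
    exact H k l

theorem equivalence_seaweedPattern_self (a : List ℕ) (n : ℕ) :
    Equivalence (seaweedPattern a a n) :=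
  ⟨fun _ => ⟨.refl _ _, .refl _ _⟩, fun h => ⟨h.2, h.1⟩,
    fun h h' => ⟨h.1.trans h'.1, h'.2.trans h.2⟩⟩

theorem le_finrank_of_splitBlock {K : Type*} [Field K] [CharZero K] {a b : List ℕ} {n : ℕ}
    (ha : a.sum = n) (h : SplitBlock a b) (F : Matrix (Fin n) (Fin n) K) :
    n ≤ Module.finrank K (patternStabilizer (seaweedPattern a b n) F) + 1 := by
  obtain ⟨i, j, hij, hj, hji, H⟩ := h.exists_cut
  rw [ha] at hj
  have hP : seaweedPattern a b n =
      cutPattern (seaweedPattern a a n) ⟨i, hij.trans hj⟩ ⟨j, hj⟩ := by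
    funext k l
    simpa [cutPattern, seaweedPattern, Fin.ext_iff] using H k l
  have := card_le_finrank_cutPattern (equivalence_seaweedPattern_self a n)
    (i := ⟨i, hij.trans hj⟩) (j := ⟨j, hj⟩) (by simpa [Fin.ext_iff] using hij.ne)
    ⟨flagLE_of_le _ hij.le, hji⟩ F
  rwa [← hP, Fintype.card_fin] at this

/-! ### The index of a seaweed subalgebra -/

section

variable {K : Type*} [Field K] {n : ℕ}

theorem mem_span_single_image_iff (s : Set (Fin n)) (v : Fin n → K) :
    v ∈ Submodule.span K ((fun k : Fin n => (Pi.single k 1 : Fin n → K)) '' s) ↔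
      ∀ k, k ∉ s → v k = 0 := by
  constructor
  · intro hv
    induction hv using Submodule.span_induction with
    | mem x hx =>
      obtain ⟨k, hk, rfl⟩ := hx
      intro l hl
      exact Pi.single_eq_of_ne (by rintro rfl; exact hl hk) _
    | zero => intro _ _; rfl
    | add x y _ _ hx hy => intro k hk; simp [hx k hk, hy k hk]
    | smul c x _ hx => intro k hk; simp [hx k hk]
  · intro h
    have : v = ∑ k, v k • (Pi.single k 1 : Fin n → K) := by
      ext l
      simp [Finset.sum_apply, Pi.single_apply]
    rw [this]
    refine Submodule.sum_mem _ fun k _ => ?_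
    by_cases hk : k ∈ s
    · exact Submodule.smul_mem _ _ (Submodule.subset_span ⟨k, hk, rfl⟩)
    · rw [h k hk, zero_smul]
      exact Submodule.zero_mem _

theorem mem_slStabilizer_span_single_iff (s : Set (Fin n))
    (x : LieAlgebra.SpecialLinear.sl (Fin n) K) :
    x ∈ slStabilizer K
        (Submodule.span K ((fun k : Fin n => (Pi.single k 1 : Fin n → K)) '' s)) ↔
      ∀ k l, l ∈ s → k ∉ s → (x : Matrix (Fin n) (Fin n) K) k l = 0 := by
  change (∀ v ∈ _, (x : Matrix (Fin n) (Fin n) K).mulVec v ∈ _) ↔ _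
  constructor
  · intro h k l hl hk
    have := h _ (Submodule.subset_span ⟨l, hl, rfl⟩)
    rw [mem_span_single_image_iff] at this
    simpa using this k hk
  · intro h v hv
    rw [mem_span_single_image_iff] at hv ⊢
    intro k hk
    rw [Matrix.mulVec, dotProduct]
    refine Finset.sum_eq_zero fun l _ => ?_
    by_cases hl : l ∈ s
    · rw [h k l hl hk, zero_mul]
    · rw [hv l hl, mul_zero]

theorem mem_sl_iff {x : Matrix (Fin n) (Fin n) K} :
    x ∈ LieAlgebra.SpecialLinear.sl (Fin n) K ↔ x.trace = 0 :=
  Iff.rfl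

theorem mem_seaweed_iff (a b : Composition n) (x : LieAlgebra.SpecialLinear.sl (Fin n) K) :
    x ∈ seaweed K a b ↔ ∀ k l, ¬ seaweedPattern a.blocks b.blocks n k l →
      (x : Matrix (Fin n) (Fin n) K) k l = 0 := by
  unfold seaweed
  have hInf : ∀ S : ℕ → LieSubalgebra K (LieAlgebra.SpecialLinear.sl (Fin n) K),
      x ∈ ⨅ i, S i ↔ ∀ i, x ∈ S i := fun S => by
    rw [iInf, ← SetLike.mem_coe, LieSubalgebra.coe_sInf]
    simp
  rw [LieSubalgebra.mem_inf, hInf, hInf]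
  simp only [ ascendingFlag, descendingFlag,
    mem_slStabilizer_span_single_iff, Set.mem_ofPred_eq, not_lt, not_le]
  constructor
  · rintro ⟨h1, h2⟩ k l h
    rw [seaweedPattern, not_and_or] at h
    simp only [FlagLE, not_forall, not_lt] at h
    rcases h with ⟨i, hi, hi'⟩ | ⟨i, hi, hi'⟩
    · exact h1 i k l hi hi'
    · exact h2 i k l hi' hi
  · intro h
    exact ⟨fun i k l hl hk => h k l fun h' => absurd (h'.1 i hl) (not_lt.mpr hk),
      fun i k l hl hk => h k l fun h' => absurd (h'.2 i hk) (not_lt.mpr hl)⟩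

/-- The linear form `x ↦ tr (F x)` on a seaweed subalgebra. -/
def traceForm (a b : Composition n) (F : Matrix (Fin n) (Fin n) K) :
    Module.Dual K (seaweed K a b) where
  toFun x := (F * (x.1.1 : Matrix (Fin n) (Fin n) K)).trace
  map_add' x y := by
    change (F * (x.1.1 + y.1.1)).trace = _
    rw [mul_add, Matrix.trace_add]
  map_smul' c x := by
    change (F * (c • x.1.1)).trace = _
    rw [Matrix.mul_smul, Matrix.trace_smul]
    rfl

/-- Every form on the seaweed extends to all matrices, hence is a trace form. -/
theorem exists_traceForm_eq (a b : Composition n) (f : Module.Dual K (seaweed K a b)) :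
    ∃ F, traceForm a b F = f := by
  let ι : seaweed K a b →ₗ[K] Matrix (Fin n) (Fin n) K :=
    { toFun := fun x => x.1.1
      map_add' := fun _ _ => rfl
      map_smul' := fun _ _ => rfl }
  have hι : LinearMap.ker ι = ⊥ := by
    rw [LinearMap.ker_eq_bot]
    exact fun x y h => Subtype.ext (Subtype.ext h)
  obtain ⟨g, hg⟩ := ι.exists_leftInverse_of_injective hι
  refine ⟨Matrix.of fun l k => f (g (Matrix.single k l 1)), LinearMap.ext fun x => ?_⟩
  have hx : f x = f (g (ι x)) := congrArg f (LinearMap.congr_fun hg x).symm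
  have hs : ι x = ∑ k, ∑ l, ι x k l • Matrix.single k l (1 : K) := by
    conv_lhs => rw [Matrix.matrix_eq_sum_single (ι x)]
    simp [Matrix.smul_single]
  rw [hx, hs]
  simp only [map_sum, map_smul, smul_eq_mul]
  change Matrix.trace (_ * ι x) = _
  rw [Matrix.trace, Finset.sum_comm]
  simp only [Matrix.diag_apply, Matrix.mul_apply, Matrix.of_apply]
  exact Finset.sum_congr rfl fun l _ => Finset.sum_congr rfl fun k _ => mul_comm _ _

theorem trace_mul_commutator (F x y : Matrix (Fin n) (Fin n) K) :
    (F * (x * y - y * x)).trace = ((F * x - x * F) * y).trace := by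
  rw [mul_sub, sub_mul, Matrix.trace_sub, Matrix.trace_sub, ← Matrix.mul_assoc,
    ← Matrix.mul_assoc, Matrix.trace_mul_comm (F * y) x, ← Matrix.mul_assoc]

variable [CharZero K]

theorem mem_ker_kirillovForm_traceForm_iff (hn : 0 < n) (a b : Composition n)
    (F : Matrix (Fin n) (Fin n) K) (x : seaweed K a b) :
    x ∈ LinearMap.ker (kirillovForm (traceForm a b F)) ↔
      x.1.1 ∈ patternStabilizer (seaweedPattern a.blocks b.blocks n) F := by
  have hval : ∀ y : seaweed K a b, kirillovForm (traceForm a b F) x y =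
      ((F * x.1.1 - x.1.1 * F) * y.1.1).trace := fun y => by
    rw [← trace_mul_commutator]
    rfl
  have hn' : (n : K) ≠ 0 := Nat.cast_ne_zero.mpr hn.ne'
  rw [LinearMap.mem_ker, mem_patternStabilizer]
  constructor
  · intro h
    refine ⟨(mem_seaweed_iff a b x.1).1 x.2, fun i j hij => ?_⟩
    -- the traceless part of the matrix unit at `(i, j)`
    let y : Matrix (Fin n) (Fin n) K :=
      Matrix.single i j 1 - ((Matrix.single i j (1 : K)).trace / n) • 1
    have hy : y ∈ LieAlgebra.SpecialLinear.sl (Fin n) K := by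
      rw [mem_sl_iff]
      simp [y, Matrix.trace_sub, Matrix.trace_smul, hn']
    have hy' : (⟨y, hy⟩ : LieAlgebra.SpecialLinear.sl (Fin n) K) ∈ seaweed K a b := by
      rw [mem_seaweed_iff]
      intro k l hkl
      have h1 : k ≠ l := by
        rintro rfl
        exact hkl ⟨.refl _ _, .refl _ _⟩
      have h2 : ¬ (i = k ∧ j = l) := by
        rintro ⟨rfl, rfl⟩
        exact hkl hij
      simp [y, h1, h2]
    have h1 := LinearMap.congr_fun h ⟨⟨y, hy⟩, hy'⟩
    rw [hval] at h1
    have h2 : ((F * x.1.1 - x.1.1 * F) * y).trace = (F * x.1.1 - x.1.1 * F) j i := by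
      rw [mul_sub, Matrix.trace_sub, Matrix.mul_smul, Matrix.trace_smul, mul_one,
        Matrix.trace_sub, Matrix.trace_mul_comm F, sub_self, smul_zero, sub_zero]
      rw [Matrix.trace_mul_comm]
      simp [Matrix.trace_single_mul]
    rw [← h2]
    exact h1
  · rintro ⟨-, h⟩
    refine LinearMap.ext fun y => ?_
    rw [hval, LinearMap.zero_apply, Matrix.trace]
    refine Finset.sum_eq_zero fun j _ => ?_
    rw [Matrix.diag_apply, Matrix.mul_apply]
    refine Finset.sum_eq_zero fun i _ => ?_
    by_cases hij : seaweedPattern a.blocks b.blocks n i j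
    · rw [h i j hij, zero_mul]
    · have := (mem_seaweed_iff a b y.1).1 y.2 i j hij
      rw [this, mul_zero]

/-- Passing from the traceless seaweed to the one in `𝔤𝔩(n)` adds the scalar matrices to the
kernel. -/
theorem finrank_ker_kirillovForm_traceForm (hn : 0 < n) (a b : Composition n)
    (F : Matrix (Fin n) (Fin n) K) :
    Module.finrank K (LinearMap.ker (kirillovForm (traceForm a b F))) + 1 =
      Module.finrank K (patternStabilizer (seaweedPattern a.blocks b.blocks n) F) := by
  have hn' : (n : K) ≠ 0 := Nat.cast_ne_zero.mpr hn.ne'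
  have hone : (1 : Matrix (Fin n) (Fin n) K) ∈
      patternStabilizer (seaweedPattern a.blocks b.blocks n) F := by
    refine ⟨fun k l h => Matrix.one_apply_ne ?_, fun k l _ => by simp⟩
    rintro rfl
    exact h ⟨.refl _ _, .refl _ _⟩
  let φ : (LinearMap.ker (kirillovForm (traceForm a b F)) × K) →ₗ[K]
      patternStabilizer (seaweedPattern a.blocks b.blocks n) F :=
    { toFun := fun x => ⟨x.1.1.1.1, (mem_ker_kirillovForm_traceForm_iff hn a b F _).1 x.1.2⟩ +
        x.2 • ⟨1, hone⟩
      map_add' := fun x y => by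
        apply Subtype.ext
        change (x.1.1.1.1 + y.1.1.1.1) + (x.2 + y.2) • (1 : Matrix (Fin n) (Fin n) K) =
          (x.1.1.1.1 + x.2 • 1) + (y.1.1.1.1 + y.2 • 1)
        rw [add_smul]
        abel
      map_smul' := fun c x => by
        apply Subtype.ext
        change c • x.1.1.1.1 + (c * x.2) • (1 : Matrix (Fin n) (Fin n) K) =
          c • (x.1.1.1.1 + x.2 • 1)
        rw [smul_add, mul_smul] }
  have hφ : ∀ x, (φ x).1 = x.1.1.1.1 + x.2 • (1 : Matrix (Fin n) (Fin n) K) := fun _ => rfl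
  have htr : ∀ x : LinearMap.ker (kirillovForm (traceForm a b F)),
      Matrix.trace (x.1.1.1 : Matrix (Fin n) (Fin n) K) = 0 := fun x =>
    mem_sl_iff.1 x.1.1.2
  have hbij : Function.Bijective φ := by
    constructor
    · rw [← LinearMap.ker_eq_bot, LinearMap.ker_eq_bot']
      rintro ⟨x, c⟩ h
      have h1 : x.1.1.1 + c • (1 : Matrix (Fin n) (Fin n) K) = 0 := congrArg Subtype.val h
      have hc : c = 0 := by
        have := congrArg Matrix.trace h1
        simpa [htr, hn'] using this
      subst hc
      rw [zero_smul, add_zero] at h1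
      have hx : x = 0 := Subtype.ext (Subtype.ext (Subtype.ext h1))
      rw [hx]
      rfl
    · rintro ⟨y, hy⟩
      let z : Matrix (Fin n) (Fin n) K := y - (y.trace / n) • 1
      have hz : z ∈ LieAlgebra.SpecialLinear.sl (Fin n) K := by
        rw [mem_sl_iff]
        simp [z, Matrix.trace_sub, Matrix.trace_smul, hn']
      have hzs : z ∈ patternStabilizer (seaweedPattern a.blocks b.blocks n) F :=
        Submodule.sub_mem _ hy (Submodule.smul_mem _ _ hone)
      have hz' : (⟨z, hz⟩ : LieAlgebra.SpecialLinear.sl (Fin n) K) ∈ seaweed K a b :=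
        (mem_seaweed_iff a b _).2 hzs.1
      refine ⟨(⟨⟨⟨z, hz⟩, hz'⟩, (mem_ker_kirillovForm_traceForm_iff hn a b F _).2 hzs⟩,
        y.trace / n), Subtype.ext ?_⟩
      rw [hφ]
      exact sub_add_cancel _ _
  have := (LinearEquiv.ofBijective φ hbij).finrank_eq
  rwa [Module.finrank_prod, Module.finrank_self] at this

theorem lieIndex_seaweed_add_one_le (hn : 0 < n) (a b : Composition n)
    (F : Matrix (Fin n) (Fin n) K) :
    lieIndex K (seaweed K a b) + 1 ≤
      Module.finrank K (patternStabilizer (seaweedPattern a.blocks b.blocks n) F) := by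
  rw [← finrank_ker_kirillovForm_traceForm hn]
  exact Nat.add_le_add_right (ciInf_le (OrderBot.bddBelow _) _) 1

theorem exists_lieIndex_seaweed_add_one_eq (hn : 0 < n) (a b : Composition n) :
    ∃ F : Matrix (Fin n) (Fin n) K, lieIndex K (seaweed K a b) + 1 =
      Module.finrank K (patternStabilizer (seaweedPattern a.blocks b.blocks n) F) := by
  obtain ⟨f, hf⟩ := ciInf_mem fun f : Module.Dual K (seaweed K a b) =>
    Module.finrank K (LinearMap.ker (kirillovForm f))
  obtain ⟨F, rfl⟩ := exists_traceForm_eq a b f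
  exact ⟨F, by rw [← finrank_ker_kirillovForm_traceForm hn]; exact congrArg (· + 1) hf.symm⟩

/-- A seaweed subalgebra of `𝔰𝔩(n)` has index `n - 2` if and only if one of its two compositions
arises from the other one by splitting a block. -/
theorem lieIndex_seaweed_eq_iff (hn : 0 < n) (a b : Composition n) :
    (lieIndex K (seaweed K a b) : ℤ) = (n : ℤ) - 2 ↔
      SplitBlock a.blocks b.blocks ∨ SplitBlock b.blocks a.blocks := by
  have hpair : CompositionPair a.blocks b.blocks n :=
    ⟨fun _ => a.blocks_pos, fun _ => b.blocks_pos, a.blocks_sum, b.blocks_sum⟩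
  obtain ⟨-, h1, h2⟩ := stabilizerBound (K := K) n _ _ hpair
  obtain ⟨G, hG⟩ := exists_lieIndex_seaweed_add_one_eq (K := K) hn a b
  have hle := lieIndex_seaweed_add_one_le (K := K) hn a b
  constructor
  · intro h
    by_contra hs
    rw [not_or] at hs
    by_cases hab : a.blocks = b.blocks
    · have := card_le_finrank_patternStabilizer (equivalence_seaweedPattern_self a.blocks n) G
      rw [Fintype.card_fin] at this
      rw [← hab] at hG
      omega
    · obtain ⟨F, hF⟩ := h2 hab hs.1 hs.2
      have := hle F
      omega
  · intro h
    have hne : a.blocks ≠ b.blocks := h.elim SplitBlock.ne fun h => h.ne.symm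
    obtain ⟨F, hF⟩ := h1 hne
    have hF' := hle F
    have hG' : n ≤ Module.finrank K
        (patternStabilizer (seaweedPattern a.blocks b.blocks n) G) + 1 := by
      rcases h with h | h
      · exact le_finrank_of_splitBlock a.blocks_sum h G
      · rw [← seaweedPattern_swap, ← finrank_patternStabilizer_transpose]
        exact le_finrank_of_splitBlock b.blocks_sum h G.transpose
    omega

end

/-! ### Counting split blocks -/

theorem SplitBlock.sum_eq {a b : List ℕ} (h : SplitBlock a b) : b.sum = a.sum := by
  induction h with
  | head m t =>
    simp only [List.sum_cons, sum_consBlock]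
    ring
  | cons h _ ih => rw [List.sum_cons, List.sum_cons, ih]

theorem SplitBlock.pos {a b : List ℕ} (h : SplitBlock a b) (ha : ∀ x ∈ a, 0 < x) :
    ∀ x ∈ b, 0 < x := by
  induction h with
  | head m t =>
    rw [List.forall_mem_cons] at ha ⊢
    exact ⟨one_pos, pos_of_mem_consBlock (List.forall_mem_cons.2 ⟨one_pos, ha.2⟩)⟩
  | cons h _ ih =>
    rw [List.forall_mem_cons] at ha ⊢
    exact ⟨ha.1, ih ha.2⟩

/-- Each block of size at least two can be split in exactly one way. -/
theorem exists_finset_mem_iff_splitBlock (a : List ℕ) :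
    ∃ s : Finset (List ℕ), (∀ b, b ∈ s ↔ SplitBlock a b) ∧ s.card = a.countP (2 ≤ ·) := by
  induction a with
  | nil =>
    refine ⟨∅, fun b => ⟨fun h => by simp at h, fun h => by cases h⟩, by simp⟩
  | cons h t ih =>
    obtain ⟨s, hs, hc⟩ := ih
    have hinj : Function.Injective (fun l : List ℕ => h :: l) := List.cons_injective
    by_cases h2 : 2 ≤ h
    · obtain ⟨m, rfl⟩ := Nat.exists_eq_add_of_le' h2
      have hnot : 1 :: consBlock m (1 :: t) ∉ s.image (fun l => (m + 2) :: l) := by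
        intro hmem
        obtain ⟨l, -, hl⟩ := Finset.mem_image.1 hmem
        have := (List.cons.inj hl).1
        omega
      refine ⟨insert (1 :: consBlock m (1 :: t)) (s.image (fun l => (m + 2) :: l)),
        fun b => ?_, ?_⟩
      · rw [Finset.mem_insert, Finset.mem_image]
        constructor
        · rintro (rfl | ⟨l, hl, rfl⟩)
          · exact .head m t
          · exact .cons _ ((hs l).1 hl)
        · intro hb
          cases hb with
          | head => exact .inl rfl
          | cons _ hb => exact .inr ⟨_, (hs _).2 hb, rfl⟩
      · rw [Finset.card_insert_of_notMem hnot, Finset.card_image_of_injective _ hinj, hc,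
          List.countP_cons_of_pos (by simp)]
    · refine ⟨s.image (fun l => h :: l), fun b => ?_, ?_⟩
      · rw [Finset.mem_image]
        constructor
        · rintro ⟨l, hl, rfl⟩
          exact .cons _ ((hs l).1 hl)
        · intro hb
          cases hb with
          | head => omega
          | cons _ hb => exact ⟨_, (hs _).2 hb, rfl⟩
      · rw [Finset.card_image_of_injective _ hinj, hc, List.countP_cons_of_neg (by simpa using h2)]

theorem card_splitBlock {n : ℕ} (a : Composition n) :
    Nat.card {b : Composition n // SplitBlock a.blocks b.blocks} = a.blocks.countP (2 ≤ ·) := by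
  obtain ⟨s, hs, hc⟩ := exists_finset_mem_iff_splitBlock a.blocks
  rw [← hc, ← Set.ncard_coe_finset, ← Nat.card_coe_set_eq]
  refine Nat.card_eq_of_bijective
    (fun b => (⟨b.1.blocks, Finset.mem_coe.2 ((hs _).2 b.2)⟩ : (s : Set (List ℕ)))) ⟨?_, ?_⟩
  · intro b b' h
    exact Subtype.ext (Composition.ext (congrArg Subtype.val h))
  · rintro ⟨l, hl⟩
    have hl' := (hs l).1 (Finset.mem_coe.1 hl)
    exact ⟨⟨⟨l, fun {x} => hl'.pos (fun _ => a.blocks_pos) x, hl'.sum_eq.trans a.blocks_sum⟩, hl'⟩,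
      rfl⟩

/-- The blocks of the compositions of `n`. -/
def compositionLists (n : ℕ) : Finset (List ℕ) :=
  Finset.univ.map ⟨Composition.blocks (n := n), fun _ _ => Composition.ext⟩

theorem mem_compositionLists {n : ℕ} {l : List ℕ} :
    l ∈ compositionLists n ↔ (∀ x ∈ l, 0 < x) ∧ l.sum = n := by
  rw [compositionLists, Finset.mem_map]
  constructor
  · rintro ⟨c, -, rfl⟩
    exact ⟨fun _ => c.blocks_pos, c.blocks_sum⟩
  · rintro ⟨h1, h2⟩
    exact ⟨⟨l, fun {x} => h1 x, h2⟩, Finset.mem_univ _, rfl⟩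

theorem sum_compositionLists (n : ℕ) (f : List ℕ → ℕ) :
    ∑ l ∈ compositionLists n, f l = ∑ c : Composition n, f c.blocks := by
  rw [compositionLists, Finset.sum_map]
  rfl

/-- The first part of a composition of `n + 2` is either `1` or exceeds by one the first part of
a composition of `n + 1`. -/
theorem sum_compositionLists_add_two (n : ℕ) (f : List ℕ → ℕ) :
    ∑ l ∈ compositionLists (n + 2), f l = ∑ l ∈ compositionLists (n + 1),
      (f (1 :: l) + f ((l.headI + 1) :: l.tail)) := by
  have h1 : Set.InjOn (fun l : List ℕ => 1 :: l) (compositionLists (n + 1)) :=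
    List.cons_injective.injOn
  have hne : ∀ l ∈ compositionLists (n + 1), l.headI :: l.tail = l := by
    intro l hl
    rcases l with _ | ⟨h, t⟩
    · simp [mem_compositionLists] at hl
    · rfl
  have h2 : Set.InjOn (fun l : List ℕ => (l.headI + 1) :: l.tail) (compositionLists (n + 1)) := by
    intro l hl l' hl' h
    obtain ⟨h3, h4⟩ := List.cons.inj h
    rw [← hne l hl, ← hne l' hl', h4, Nat.add_right_cancel h3]
  have hdisj : Disjoint ((compositionLists (n + 1)).image (fun l => 1 :: l))
      ((compositionLists (n + 1)).image (fun l => (l.headI + 1) :: l.tail)) := by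
    rw [Finset.disjoint_left]
    intro l hl hl'
    obtain ⟨l₁, -, rfl⟩ := Finset.mem_image.1 hl
    obtain ⟨l₂, h3, h4⟩ := Finset.mem_image.1 hl'
    have h5 := (List.cons.inj h4).1
    rw [← hne l₂ h3] at h3
    have := (mem_compositionLists.1 h3).1 l₂.headI (by simp)
    omega
  have hunion : compositionLists (n + 2) = (compositionLists (n + 1)).image (fun l => 1 :: l) ∪
      (compositionLists (n + 1)).image (fun l => (l.headI + 1) :: l.tail) := by
    ext l
    simp only [Finset.mem_union, Finset.mem_image]
    constructor
    · intro hl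
      rcases l with _ | ⟨_ | _ | h, t⟩
      · simp [mem_compositionLists] at hl
      · simp [mem_compositionLists] at hl
      · simp only [mem_compositionLists, List.forall_mem_cons, List.sum_cons] at hl
        exact .inl ⟨t, mem_compositionLists.2 ⟨hl.1.2, by omega⟩, by simp⟩
      · simp only [mem_compositionLists, List.forall_mem_cons, List.sum_cons] at hl
        refine .inr ⟨(h + 1) :: t, mem_compositionLists.2
          ⟨List.forall_mem_cons.2 ⟨by omega, hl.1.2⟩, ?_⟩, rfl⟩
        rw [List.sum_cons]
        omega
    · rintro (⟨l, hl, rfl⟩ | ⟨l, hl, rfl⟩)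
      · rw [mem_compositionLists] at hl ⊢
        exact ⟨List.forall_mem_cons.2 ⟨one_pos, hl.1⟩, by rw [List.sum_cons]; omega⟩
      · rw [← hne l hl] at hl
        simp only [mem_compositionLists, List.forall_mem_cons, List.sum_cons] at hl ⊢
        exact ⟨⟨by omega, hl.1.2⟩, by omega⟩
  rw [hunion, Finset.sum_union hdisj, Finset.sum_image h1, Finset.sum_image h2,
    Finset.sum_add_distrib]

/-- The number of compositions of `n + 2` whose first part is `1`. -/
theorem sum_ite_head_eq_one (n : ℕ) :
    ∑ l ∈ compositionLists (n + 2), (if l.headI = 1 then 1 else 0) = 2 ^ n := by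
  have h : ∀ l ∈ compositionLists (n + 1), (l.headI + 1 = 1) = False := by
    intro l hl
    rcases l with _ | ⟨h, t⟩
    · simp [mem_compositionLists] at hl
    · simp only [mem_compositionLists, List.forall_mem_cons] at hl
      simp only [List.headI_cons, eq_iff_iff, iff_false]
      omega
  rw [sum_compositionLists_add_two]
  have h2 : ∀ l ∈ compositionLists (n + 1),
      ((if (1 :: l).headI = 1 then 1 else 0) +
        if ((l.headI + 1) :: l.tail).headI = 1 then 1 else 0) = 1 := by
    intro l hl
    simp only [List.headI_cons, h l hl, if_true, if_false]
  rw [Finset.sum_congr rfl h2, sum_compositionLists]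
  simp [composition_card]

/-- Increasing the first part creates a new block of size at least two exactly if this part is
`1`. -/
theorem sum_countP_add_two (n : ℕ) :
    ∑ l ∈ compositionLists (n + 2), l.countP (2 ≤ ·) =
      2 * ∑ l ∈ compositionLists (n + 1), l.countP (2 ≤ ·) +
        ∑ l ∈ compositionLists (n + 1), (if l.headI = 1 then 1 else 0) := by
  rw [sum_compositionLists_add_two, Finset.mul_sum, ← Finset.sum_add_distrib]
  refine Finset.sum_congr rfl fun l hl => ?_
  rcases l with _ | ⟨h, t⟩
  · simp [mem_compositionLists] at hl
  · simp only [mem_compositionLists, List.forall_mem_cons] at hl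
    simp only [List.headI_cons, List.tail_cons, List.countP_cons, decide_eq_true_eq]
    by_cases h1 : h = 1
    · subst h1
      simp
      omega
    · have h2 : 2 ≤ h := by omega
      have h3 : 2 ≤ h + 1 := by omega
      simp [h1, h2, h3]
      omega

theorem compositionLists_one : compositionLists 1 = {[1]} := by
  ext l
  rw [mem_compositionLists, Finset.mem_singleton]
  constructor
  · rintro ⟨h1, h2⟩
    rcases l with _ | ⟨h, _ | ⟨h', t⟩⟩
    · simp at h2
    · simpa using h2
    · simp only [List.forall_mem_cons, List.sum_cons] at h1 h2
      omega
  · rintro rfl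
    simp

/-- Twice the total number of blocks of size at least two in the compositions of `n + 2`. -/
theorem two_mul_sum_countP (n : ℕ) :
    2 * ∑ l ∈ compositionLists (n + 2), l.countP (2 ≤ ·) = (n + 2) * 2 ^ n := by
  induction n with
  | zero =>
    rw [sum_countP_add_two, compositionLists_one, Finset.sum_singleton, Finset.sum_singleton]
    rfl
  | succ n ih =>
    rw [sum_countP_add_two, sum_ite_head_eq_one, ih]
    ring

theorem card_splitBlock_pairs (n : ℕ) :
    Nat.card {p : Composition n × Composition n // SplitBlock p.1.blocks p.2.blocks} =
      ∑ l ∈ compositionLists n, l.countP (2 ≤ ·) := by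
  rw [sum_compositionLists, Nat.card_congr (Equiv.subtypeProdEquivSigmaSubtype
    fun a b : Composition n => SplitBlock a.blocks b.blocks), Nat.card_sigma]
  exact Finset.sum_congr rfl fun a _ => card_splitBlock a

theorem seaweedCount_eq (K : Type*) [Field K] [CharZero K] {n : ℕ} (hn : 0 < n) :
    seaweedCount K n ((n : ℤ) - 2) = 2 * ∑ l ∈ compositionLists n, l.countP (2 ≤ ·) := by
  have h1 : seaweedCount K n ((n : ℤ) - 2) =
      ({p : Composition n × Composition n | SplitBlock p.1.blocks p.2.blocks} ∪
        {p | SplitBlock p.2.blocks p.1.blocks}).ncard := by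
    rw [seaweedCount, ← Nat.card_coe_set_eq]
    exact Nat.card_congr (Equiv.subtypeEquivRight fun p => lieIndex_seaweed_eq_iff hn p.1 p.2)
  have hdisj : Disjoint
      {p : Composition n × Composition n | SplitBlock p.1.blocks p.2.blocks}
      {p | SplitBlock p.2.blocks p.1.blocks} := by
    rw [Set.disjoint_left]
    intro p hp hp'
    exact lt_asymm (SplitBlock.length_lt hp) (SplitBlock.length_lt hp')
  have h2 : {p : Composition n × Composition n | SplitBlock p.2.blocks p.1.blocks}.ncard =
      {p : Composition n × Composition n | SplitBlock p.1.blocks p.2.blocks}.ncard := by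
    rw [← Nat.card_coe_set_eq, ← Nat.card_coe_set_eq]
    exact Nat.card_congr ((Equiv.prodComm _ _).subtypeEquiv fun p => Iff.rfl)
  rw [h1, Set.ncard_union_eq hdisj (Set.toFinite _) (Set.toFinite _), h2, ← two_mul,
    ← card_splitBlock_pairs, ← Nat.card_coe_set_eq]
  rfl

/-! ### The generating function -/

theorem mainTheorem8 (K : Type*) [Field K] [IsAlgClosed K] [CharZero K] :
    PowerSeries.mk (fun n : ℕ => if 0 < n then (seaweedCount K n ((n : ℤ) - 2) : ℚ) else 0) =
      (2 * PowerSeries.X ^ 2 - 2 * PowerSeries.X ^ 3) * ((1 - 2 * PowerSeries.X) ^ 2)⁻¹ := by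
  set f : ℕ → ℚ := fun n => if 0 < n then (seaweedCount K n ((n : ℤ) - 2) : ℚ) else 0 with hf
  have h0 : f 0 = 0 := rfl
  have h1 : f 1 = 0 := by
    have := seaweedCount_eq K one_pos
    rw [compositionLists_one] at this
    simp only [hf, one_pos, if_true]
    rw [this]
    simp
  have h2 : ∀ n, f (n + 2) = (n + 2) * 2 ^ n := by
    intro n
    have := seaweedCount_eq K (Nat.succ_pos (n + 1))
    rw [two_mul_sum_countP] at this
    simp only [hf, Nat.succ_pos, if_true]
    rw [this]
    push_cast
    ring
  rw [PowerSeries.eq_mul_inv_iff_mul_eq (by simp)]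
  have e1 : PowerSeries.mk f * (1 - 2 * PowerSeries.X) ^ 2 = PowerSeries.mk f -
      PowerSeries.C 4 * (PowerSeries.mk f * PowerSeries.X ^ 1) +
      PowerSeries.C 4 * (PowerSeries.mk f * PowerSeries.X ^ 2) := by
    have : (PowerSeries.C 4 : PowerSeries ℚ) = 4 := map_ofNat _ 4
    rw [this]
    ring
  have e2 : (2 * PowerSeries.X ^ 2 - 2 * PowerSeries.X ^ 3 : PowerSeries ℚ) =
      PowerSeries.C 2 * PowerSeries.X ^ 2 - PowerSeries.C 2 * PowerSeries.X ^ 3 := by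
    have : (PowerSeries.C 2 : PowerSeries ℚ) = 2 := map_ofNat _ 2
    rw [this]
  rw [e1, e2]
  ext n
  simp only [map_add, map_sub, PowerSeries.coeff_C_mul, PowerSeries.coeff_mk,
    PowerSeries.coeff_mul_X_pow', PowerSeries.coeff_C]
  rcases n with _ | _ | _ | _ | n
  · simp [h0]
  · simp [h0, h1]
  · simp [h0, h1, h2]
  · simp [h1, h2 0, h2 1]
    norm_num
  · have e3 : n + 1 + 1 + 1 + 1 - 1 = n + 1 + 2 := by omega
    have e4 : n + 1 + 1 + 1 + 1 - 2 = n + 2 := by omega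
    have e5 : n + 1 + 1 + 1 + 1 = n + 2 + 2 := by omega
    have e6 : n + 2 + 2 - 3 = n + 1 := by omega
    rw [e3, e4, e5, e6, h2, h2, h2]
    simp
    ring
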